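/- Let $\phi_{ij}\in\mathbb{C}[V]=\mathbb{C}[x_1,x_2,x_3,x_4]$ $(0\le i<j\le 4)$ be the polynomials $$\begin{array}{ll} \phi_{13}=-x_1^2-x_2^2+x_3^2+x_4^2, & \phi_{14}=\sqrt{-1}\,(x_1^2+x_2^2+x_3^2+x_4^2),\\ \phi_{34}=2(x_1x_3+x_2x_4), & \phi_{01}=-2(x_1x_4+x_2x_3),\\ \phi_{03}=2\sqrt{-1}\,(x_1x_2+x_3x_4), & \phi_{04}=2(-x_1x_2+x_3x_4),\\ \phi_{12}=2(x_1x_3-x_2x_4), & \phi_{23}=\sqrt{-1}\,(-x_1^2+x_2^2-x_3^2+x_4^2),\\ \phi_{24}=x_1^2-x_2^2-x_3^2+x_4^2, & \phi_{02}=2\sqrt{-1}\,(-x_1x_4+x_2x_3). \end{array}$$ Put $\overline{\phi}_{ij}=\phi_{ij}\prod_{k\in\{i,j\}\cap\{0,2\}}t_k$. Let $\mathcal R\subset\mathbb{C}[V][t_0^{\pm1},t_2^{\pm1}]$ be the $\mathbb{C}$-subalgebra generated by all $\overline{\phi}_{ij}$ and by $t_0^{-2},t_2^{-2}$, and let $\mathcal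 R'\subset\mathbb{C}[V][t_0^{\pm1},\dots,t_4^{\pm1}]$ be the $\mathbb{C}$-subalgebra generated by all $\phi_{ij}t_it_j$ and by $t_k^{-2}$, $k=0,\dots,4$. Consider the surjective $\mathbb{C}$-algebra homomorphisms $$\Psi:\mathbb{C}[w_{ij},u_0,u_2]\to\mathcal R,\quad w_{ij}\mapsto\overline{\phi}_{ij},\ u_k\mapsto t_k^{-2},\qquad \Phi:\mathbb{C}[w_{ij},u_0,\dots,u_4]\to\mathcal R',\quad w_{ij}\mapsto\phi_{ij}t_it_j,\ u_k\mapsto t_k^{-2},$$ and the corresponding closed embeddings $\operatorname{Spec}\mathcal R\subset\mathbb{C}^{12}$, $\operatorname{Spec}\mathcal R'\subset\mathbb{C}^{15}$. (a) The kernel of $\Psi$ is generated by the following 20 polynomials: $$\begin{array}{ll} w_{14}w_{23}+w_{13}w_{24}-w_{12}w_{34}, & w_{04}w_{23}-w_{03}w_{24}-w_{02}w_{34},\\ w_{04}w_{13}+w_{03}w_{14}-w_{01}w_{34}, & w_{04}w_{12}-w_{02}w_{14}-w_{01}w_{24},\\ w_{03}w_{12}+w_{02}w_{13}-w_{01}w_{23},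 & w_{02}w_{12}u_2-w_{03}w_{13}+w_{04}w_{14},\\ w_{01}w_{14}-w_{02}w_{24}u_2+w_{03}w_{34}, & w_{01}w_{13}+w_{02}w_{23}u_2+w_{04}w_{34},\\ w_{01}w_{12}+w_{03}w_{23}+w_{04}w_{24}, & w_{03}w_{04}u_0-w_{13}w_{14}+w_{23}w_{24}u_2,\\ w_{02}w_{04}u_0+w_{12}w_{14}+w_{23}w_{34}, & w_{01}w_{04}u_0+w_{12}w_{24}u_2+w_{13}w_{34},\\ w_{02}w_{03}u_0-w_{12}w_{13}-w_{24}w_{34}, & w_{01}w_{03}u_0+w_{12}w_{23}u_2+w_{14}w_{34},\\ w_{01}w_{02}u_0+w_{13}w_{23}-w_{14}w_{24}, & w_{02}^2u_0+w_{12}^2+w_{23}^2+w_{24}^2,\\ w_{03}^2u_0+w_{13}^2+w_{23}^2u_2+w_{34}^2, & w_{01}^2+w_{02}^2u_2+w_{03}^2+w_{04}^2,\\ w_{04}^2u_0+w_{14}^2+w_{24}^2u_2+w_{34}^2, & w_{01}^2u_0+w_{12}^2u_2+w_{13}^2+w_{14}^2. \end{array}$$ (b) These are obtained by the substitution $u_1,u_3,u_4\mapsto1$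 from the following generators of $\ker\Phi$ (in the same order): $$\begin{array}{ll} w_{14}w_{23}+w_{13}w_{24}-w_{12}w_{34}, & w_{04}w_{23}-w_{03}w_{24}-w_{02}w_{34},\\ w_{04}w_{13}+w_{03}w_{14}-w_{01}w_{34}, & w_{04}w_{12}-w_{02}w_{14}-w_{01}w_{24},\\ w_{03}w_{12}+w_{02}w_{13}-w_{01}w_{23}, & w_{02}w_{12}u_2-w_{03}w_{13}u_3+w_{04}w_{14}u_4,\\ w_{01}w_{14}u_1-w_{02}w_{24}u_2+w_{03}w_{34}u_3, & w_{01}w_{13}u_1+w_{02}w_{23}u_2+w_{04}w_{34}u_4,\\ w_{01}w_{12}u_1+w_{03}w_{23}u_3+w_{04}w_{24}u_4, & w_{03}w_{04}u_0-w_{13}w_{14}u_1+w_{23}w_{24}u_2,\\ w_{02}w_{04}u_0+w_{12}w_{14}u_1+w_{23}w_{34}u_3, & w_{01}w_{04}u_0+w_{12}w_{24}u_2+w_{13}w_{34}u_3,\\ w_{02}w_{03}u_0-w_{12}w_{13}u_1-w_{24}w_{34}u_4, & w_{01}w_{03}u_0+w_{12}w_{23}u_2+w_{14}w_{34}u_4,\\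 w_{01}w_{02}u_0+w_{13}w_{23}u_3-w_{14}w_{24}u_4, & w_{02}^2u_0+w_{12}^2u_1+w_{23}^2u_3+w_{24}^2u_4,\\ w_{03}^2u_0+w_{13}^2u_1+w_{23}^2u_2+w_{34}^2u_4, & w_{01}^2u_1+w_{02}^2u_2+w_{03}^2u_3+w_{04}^2u_4,\\ w_{04}^2u_0+w_{14}^2u_1+w_{24}^2u_2+w_{34}^2u_3, & w_{01}^2u_0+w_{12}^2u_2+w_{13}^2u_3+w_{14}^2u_4. \end{array}$$ (c) Identify $\mathbb{C}^{12}$ with the affine subspace $u_1=u_3=u_4=1$ of $\mathbb{C}^{15}$ (the closed subscheme with ideal $(u_1-1,u_3-1,u_4-1)$), and let $\operatorname{Spec}\mathcal R\to\operatorname{Spec}\mathcal R'$ be induced by $t_1,t_3,t_4\mapsto1$. Then $\operatorname{Spec}\mathcal R=\mathbb{C}^{12}\cap\operatorname{Spec}\mathcal R'$ as closed subschemes of $\mathbb{C}^{15}$, that is, the resulting square of closed embeddings is cartesian. -/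

import Mathlib

open MvPolynomial CategoryTheory AlgebraicGeometry

noncomputable section

namespace CoxD8

/-- The pairs `(i, j)` with `0 ≤ i < j ≤ 4`; `eij` stands for `(i, j)`. -/
inductive Edge where
  | e01 | e02 | e03 | e04 | e12 | e13 | e14 | e23 | e24 | e34
  deriving DecidableEq

open Edge

/-- The smaller entry of a pair. -/
def Edge.fst : Edge → Fin 5
  | e01 => 0 | e02 => 0 | e03 => 0 | e04 => 0 | e12 => 1
  | e13 => 1 | e14 => 1 | e23 => 2 | e24 => 2 | e34 => 3

/-- The larger entry of a pair. -/
def Edge.snd : Edge → Fin 5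
  | e01 => 1 | e02 => 2 | e03 => 3 | e04 => 4 | e12 => 2
  | e13 => 3 | e14 => 4 | e23 => 3 | e24 => 4 | e34 => 4

/-- The index set `{0, 2}`. -/
abbrev K : Type := {k : Fin 5 // k = 0 ∨ k = 2}

/-- The element `0` of `{0, 2}`. -/
abbrev k0 : K := ⟨0, Or.inl rfl⟩

/-- The element `2` of `{0, 2}`. -/
abbrev k2 : K := ⟨2, Or.inr rfl⟩

/-- The coordinates `x₁, x₂, x₃, x₄` on `V = ℂ⁴` are `x 0, x 1, x 2, x 3`. -/
abbrev x (i : Fin 4) : MvPolynomial (Fin 4) ℂ := X i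

/-- The polynomials `φ_ij` on `V`. They are invariant under `-id`. -/
def phi : Edge → MvPolynomial (Fin 4) ℂ
  | e13 => -x 0 ^ 2 - x 1 ^ 2 + x 2 ^ 2 + x 3 ^ 2
  | e14 => C Complex.I * (x 0 ^ 2 + x 1 ^ 2 + x 2 ^ 2 + x 3 ^ 2)
  | e34 => 2 * (x 0 * x 2 + x 1 * x 3)
  | e01 => -2 * (x 0 * x 3 + x 1 * x 2)
  | e03 => 2 * C Complex.I * (x 0 * x 1 + x 2 * x 3)
  | e04 => 2 * (-(x 0 * x 1) + x 2 * x 3)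
  | e12 => 2 * (x 0 * x 2 - x 1 * x 3)
  | e23 => C Complex.I * (-x 0 ^ 2 + x 1 ^ 2 - x 2 ^ 2 + x 3 ^ 2)
  | e24 => x 0 ^ 2 - x 1 ^ 2 - x 2 ^ 2 + x 3 ^ 2
  | e02 => 2 * C Complex.I * (-(x 0 * x 3) + x 1 * x 2)

/-- Laurent polynomials in the variables `t_k`, `k ∈ σ`, over `ℂ[V] = ℂ[x₁, x₂, x₃, x₄]`. -/
abbrev Laurent (σ : Type) : Type := AddMonoidAlgebra (MvPolynomial (Fin 4) ℂ) (σ → ℤ)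

/-- The Laurent monomial `t_k ^ n`. -/
def tpow {σ : Type} [DecidableEq σ] (k : σ) (n : ℤ) : Laurent σ :=
  AddMonoidAlgebra.single (Pi.single k n) 1

/-- A polynomial in `x₁, …, x₄` as a constant Laurent polynomial. -/
def const {σ : Type} (f : MvPolynomial (Fin 4) ℂ) : Laurent σ :=
  AddMonoidAlgebra.single 0 f

/-! ### The ring `R'`, with five variables `t₀, …, t₄` -/

/-- `φ_ij t_i t_j`. -/
def phiBar' (e : Edge) : Laurent (Fin 5) :=
  const (phi e) * tpow e.fst 1 * tpow e.snd 1

/-- `R'` is generated by all `φ_ij t_i t_j` and by `t_k⁻²`, `k = 0, …, 4`. -/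
def R' : Subalgebra ℂ (Laurent (Fin 5)) :=
  Algebra.adjoin ℂ (Set.range phiBar' ∪ Set.range fun k : Fin 5 => tpow k (-2))

/-- `Φ : ℂ[w_ij, u₀, …, u₄] → R'`, `w_ij ↦ φ_ij t_i t_j`, `u_k ↦ t_k⁻²`. -/
def Phi : MvPolynomial (Edge ⊕ Fin 5) ℂ →ₐ[ℂ] R' :=
  aeval (Sum.elim
    (fun e => ⟨phiBar' e, Algebra.subset_adjoin (Or.inl ⟨e, rfl⟩)⟩)
    (fun k => ⟨tpow k (-2), Algebra.subset_adjoin (Or.inr ⟨k, rfl⟩)⟩))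

/-! ### The ring `R`, with two variables `t₀, t₂` -/

/-- The factor contributed by an index `k` to a generator of `R`:
`t_k` if `k ∈ {0, 2}`, and `1` otherwise. -/
def tfac (k : Fin 5) : Laurent K :=
  if h : k = 0 ∨ k = 2 then tpow (⟨k, h⟩ : K) 1 else 1

/-- `φ̄_ij`, the product of `φ_ij` with those of `t₀`, `t₂` whose index lies in `{i, j}`. -/
def phiBar (e : Edge) : Laurent K :=
  const (phi e) * tfac e.fst * tfac e.snd

/-- `R` is generated by all `φ̄_ij` and by `t₀⁻²`, `t₂⁻²`. -/
def R : Subalgebra ℂ (Laurent K) :=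
  Algebra.adjoin ℂ (Set.range phiBar ∪ Set.range fun k : K => tpow k (-2))

/-- `Ψ : ℂ[w_ij, u₀, u₂] → R`, `w_ij ↦ φ̄_ij`, `u_k ↦ t_k⁻²`. -/
def Psi : MvPolynomial (Edge ⊕ K) ℂ →ₐ[ℂ] R :=
  aeval (Sum.elim
    (fun e => ⟨phiBar e, Algebra.subset_adjoin (Or.inl ⟨e, rfl⟩)⟩)
    (fun k => ⟨tpow k (-2), Algebra.subset_adjoin (Or.inr ⟨k, rfl⟩)⟩))

/-! ### The maps relating the two rings -/

/-- The substitution `u₁, u₃, u₄ ↦ 1` on `ℂ[w_ij, u₀, …, u₄]`, that is, the restriction of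
functions from `ℂ¹⁵` to the affine subspace `ℂ¹² = {u₁ = u₃ = u₄ = 1}`. -/
def subst : MvPolynomial (Edge ⊕ Fin 5) ℂ →ₐ[ℂ] MvPolynomial (Edge ⊕ K) ℂ :=
  aeval (Sum.elim
    (fun e => X (Sum.inl e))
    (fun k => if h : k = 0 ∨ k = 2 then X (Sum.inr ⟨k, h⟩) else 1))

/-- The substitution `t₁, t₃, t₄ ↦ 1` on Laurent polynomials. -/
def specT : Laurent (Fin 5) →ₐ[ℂ] Laurent K :=
  AddMonoidAlgebra.mapDomainAlgHom ℂ (MvPolynomial (Fin 4) ℂ)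
    { toFun := fun n k => n k.1
      map_zero' := rfl
      map_add' := fun _ _ => rfl }

lemma specT_tpow (k : Fin 5) (n : ℤ) :
    specT (tpow k n) = if h : k = 0 ∨ k = 2 then tpow (⟨k, h⟩ : K) n else 1 := by
  simp only [specT, tpow, AddMonoidAlgebra.mapDomainAlgHom_apply, AddMonoidAlgebra.mapDomain_single]
  split_ifs with h
  · congr 1
    funext j
    simp [Pi.single_apply, Subtype.ext_iff]
  · rw [AddMonoidAlgebra.one_def]
    congr 1
    funext j
    have hj : j.1 ≠ k := fun e => h (e ▸ j.2)
    simp [hj]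

lemma specT_const (f : MvPolynomial (Fin 4) ℂ) : specT (const f) = const f := by
  simp only [specT, const, AddMonoidAlgebra.mapDomainAlgHom_apply,
    AddMonoidAlgebra.mapDomain_single]
  rfl

lemma specT_phiBar' (e : Edge) : specT (phiBar' e) = phiBar e := by
  simp only [phiBar', phiBar, map_mul, specT_const, specT_tpow, tfac]

lemma specT_mem (f : R') : specT f.1 ∈ R := by
  have hle : R' ≤ R.comap specT := by
    refine Algebra.adjoin_le ?_
    rintro _ (⟨e, rfl⟩ | ⟨k, rfl⟩)
    · change specT (phiBar' e) ∈ R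
      rw [specT_phiBar']
      exact Algebra.subset_adjoin (Or.inl ⟨e, rfl⟩)
    · change specT (tpow k (-2)) ∈ R
      rw [specT_tpow]
      split_ifs with h
      · exact Algebra.subset_adjoin (Or.inr ⟨⟨k, h⟩, rfl⟩)
      · exact one_mem R
  exact hle f.2

/-- The homomorphism `R' → R` induced by `t₁, t₃, t₄ ↦ 1`. -/
def resR : R' →ₐ[ℂ] R :=
  (specT.comp R'.val).codRestrict R specT_mem

/-! ### The corresponding morphisms of schemes -/

/-- `Spec R → ℂ¹²`. -/
def embR : Spec (CommRingCat.of R) ⟶ Spec (CommRingCat.of (MvPolynomial (Edge ⊕ K) ℂ)) :=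
  Spec.map (CommRingCat.ofHom (S := R) Psi.toRingHom)

/-- `Spec R' → ℂ¹⁵`. -/
def embR' : Spec (CommRingCat.of R') ⟶ Spec (CommRingCat.of (MvPolynomial (Edge ⊕ Fin 5) ℂ)) :=
  Spec.map (CommRingCat.ofHom (S := R') Phi.toRingHom)

/-- `Spec R → Spec R'`. -/
def embRR' : Spec (CommRingCat.of R) ⟶ Spec (CommRingCat.of R') :=
  Spec.map (CommRingCat.ofHom (R := R') (S := R) resR.toRingHom)

/-- `ℂ¹² → ℂ¹⁵`, the inclusion of the affine subspace `u₁ = u₃ = u₄ = 1`. -/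
def embA : Spec (CommRingCat.of (MvPolynomial (Edge ⊕ K) ℂ)) ⟶
    Spec (CommRingCat.of (MvPolynomial (Edge ⊕ Fin 5) ℂ)) :=
  Spec.map (CommRingCat.ofHom subst.toRingHom)

/-! ### The explicit polynomials -/

/-- The twenty polynomials in `w_ij`, `u₀`, `u₂`, as expressions in a commutative ring. -/
def relR {A : Type} [CommRing A] (w : Edge → A) (u0 u2 : A) : Fin 20 → A :=
  ![w e14 * w e23 + w e13 * w e24 - w e12 * w e34,
    w e04 * w e23 - w e03 * w e24 - w e02 * w e34,
    w e04 * w e13 + w e03 * w e14 - w e01 * w e34,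
    w e04 * w e12 - w e02 * w e14 - w e01 * w e24,
    w e03 * w e12 + w e02 * w e13 - w e01 * w e23,
    w e02 * w e12 * u2 - w e03 * w e13 + w e04 * w e14,
    w e01 * w e14 - w e02 * w e24 * u2 + w e03 * w e34,
    w e01 * w e13 + w e02 * w e23 * u2 + w e04 * w e34,
    w e01 * w e12 + w e03 * w e23 + w e04 * w e24,
    w e03 * w e04 * u0 - w e13 * w e14 + w e23 * w e24 * u2,
    w e02 * w e04 * u0 + w e12 * w e14 + w e23 * w e34,
    w e01 * w e04 * u0 + w e12 * w e24 * u2 + w e13 * w e34,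
    w e02 * w e03 * u0 - w e12 * w e13 - w e24 * w e34,
    w e01 * w e03 * u0 + w e12 * w e23 * u2 + w e14 * w e34,
    w e01 * w e02 * u0 + w e13 * w e23 - w e14 * w e24,
    w e02 ^ 2 * u0 + w e12 ^ 2 + w e23 ^ 2 + w e24 ^ 2,
    w e03 ^ 2 * u0 + w e13 ^ 2 + w e23 ^ 2 * u2 + w e34 ^ 2,
    w e01 ^ 2 + w e02 ^ 2 * u2 + w e03 ^ 2 + w e04 ^ 2,
    w e04 ^ 2 * u0 + w e14 ^ 2 + w e24 ^ 2 * u2 + w e34 ^ 2,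
    w e01 ^ 2 * u0 + w e12 ^ 2 * u2 + w e13 ^ 2 + w e14 ^ 2]

/-- The twenty polynomials in `w_ij`, `u₀, …, u₄`, as expressions in a commutative ring. -/
def relR' {A : Type} [CommRing A] (w : Edge → A) (u : Fin 5 → A) : Fin 20 → A :=
  ![w e14 * w e23 + w e13 * w e24 - w e12 * w e34,
    w e04 * w e23 - w e03 * w e24 - w e02 * w e34,
    w e04 * w e13 + w e03 * w e14 - w e01 * w e34,
    w e04 * w e12 - w e02 * w e14 - w e01 * w e24,
    w e03 * w e12 + w e02 * w e13 - w e01 * w e23,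
    w e02 * w e12 * u 2 - w e03 * w e13 * u 3 + w e04 * w e14 * u 4,
    w e01 * w e14 * u 1 - w e02 * w e24 * u 2 + w e03 * w e34 * u 3,
    w e01 * w e13 * u 1 + w e02 * w e23 * u 2 + w e04 * w e34 * u 4,
    w e01 * w e12 * u 1 + w e03 * w e23 * u 3 + w e04 * w e24 * u 4,
    w e03 * w e04 * u 0 - w e13 * w e14 * u 1 + w e23 * w e24 * u 2,
    w e02 * w e04 * u 0 + w e12 * w e14 * u 1 + w e23 * w e34 * u 3,
    w e01 * w e04 * u 0 + w e12 * w e24 * u 2 + w e13 * w e34 * u 3,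
    w e02 * w e03 * u 0 - w e12 * w e13 * u 1 - w e24 * w e34 * u 4,
    w e01 * w e03 * u 0 + w e12 * w e23 * u 2 + w e14 * w e34 * u 4,
    w e01 * w e02 * u 0 + w e13 * w e23 * u 3 - w e14 * w e24 * u 4,
    w e02 ^ 2 * u 0 + w e12 ^ 2 * u 1 + w e23 ^ 2 * u 3 + w e24 ^ 2 * u 4,
    w e03 ^ 2 * u 0 + w e13 ^ 2 * u 1 + w e23 ^ 2 * u 2 + w e34 ^ 2 * u 4,
    w e01 ^ 2 * u 1 + w e02 ^ 2 * u 2 + w e03 ^ 2 * u 3 + w e04 ^ 2 * u 4,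
    w e04 ^ 2 * u 0 + w e14 ^ 2 * u 1 + w e24 ^ 2 * u 2 + w e34 ^ 2 * u 3,
    w e01 ^ 2 * u 0 + w e12 ^ 2 * u 2 + w e13 ^ 2 * u 3 + w e14 ^ 2 * u 4]

/-- The twenty listed elements of `ℂ[w_ij, u₀, u₂]`. -/
def gen : Fin 20 → MvPolynomial (Edge ⊕ K) ℂ :=
  relR (fun e => X (Sum.inl e)) (X (Sum.inr k0)) (X (Sum.inr k2))

/-- The twenty elements of `ℂ[w_ij, u₀, …, u₄]` that become the `gen n` for `u₁ = u₃ = u₄ = 1`. -/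
def gen' : Fin 20 → MvPolynomial (Edge ⊕ Fin 5) ℂ :=
  relR' (fun e => X (Sum.inl e)) (fun k => X (Sum.inr k))

end CoxD8

end

/-!
After a change of the signs of some `w_ij`, the polynomials `gen'` say that the antisymmetric matrix
`W = (w_ij)` has vanishing `4 × 4` Pfaffians and that `W D W = 0` for `D = diag(u₀, …, u₄)`.
They vanish under `Φ` because of quadratic relations between the `φ_ij` (`relR'_phi`, `relR'_mul`).
That nothing else vanishes is proved with a basis of standard monomials.

*Spanning.* One term of each relation, and one monomial `w₃₄² u₃ u₄` from a further consequence
of the relations, are declared to be leading (`lead`). For the weights `wt` of the variables every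
leading monomial is heavier than the rest of its relation, so modulo the relations every polynomial
is a combination of standard monomials, that is, of monomials divisible by no leading monomial
(`exists_standard_sub_mem`).

*Independence.* Substitute `x₁ = a²`, `x₂ = ac`, `x₃ = ab`, `x₄ = e - bc`. For the lexicographic
order with `a > b > c > e` the leading monomials of the `φ_ij` become `a⁴`, `a³b`, `a³c`, `a²bc`,
`a²e` (`degree_toABCE_phi`). Together with the degrees in `t₀, …, t₄` their exponents tell all
standard monomials apart (`SameDegree.eq`), so the images of the standard monomials are linearly
independent (`eq_zero_of_Phi_eq_zero`), and `ker_Phi` follows. The coordinate `e` is chosen so that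
`φ₀₁` and `φ₀₂`, which involve the same two monomials `x₁x₄` and `x₂x₃`, get different ones.

For `Ψ`, the linear automorphisms of `V` in `exists_reflection` change the sign of exactly those
`φ_ij` with `k ∈ {i, j}`, for `k = 1, 3, 4`. Hence the components of an element of the kernel of `Ψ`
of given parity in `t₁, t₃, t₄` lie in the kernel too. Inserting powers of `u₁, u₃, u₄` makes each
component homogeneous in `t₁, t₃, t₄` (`homogenize`), so that the element is the image of one of
`ker Φ` under the substitution `u₁, u₃, u₄ ↦ 1`. This gives `ker_Psi`; the square of rings is then
a pushout because `ker Ψ` is generated by the image of `ker Φ` (`isPushout_of_ker_le`).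
-/

open MvPolynomial CategoryTheory AlgebraicGeometry
open scoped MonomialOrder

noncomputable section

namespace CoxD8

open Edge

/-! ### The quadratic relations between the `φ_ij` -/

lemma relR'_phi (n : Fin 20) : relR' phi (fun _ => 1) n = 0 := by
  have hI : (C Complex.I : MvPolynomial (Fin 4) ℂ) ^ 2 = -1 := by
    rw [← C_pow, Complex.I_sq, C_neg, C_1]
  fin_cases n <;> simp only [relR', phi, Matrix.cons_val, Fin.isValue, Fin.mk_one, Fin.zero_eta,
      Fin.reduceFinMk]
  · linear_combination ((x 0 ^ 2 + x 1 ^ 2 + x 2 ^ 2 + x 3 ^ 2) * (-x 0 ^ 2 + x 1 ^ 2 - x 2 ^ 2 +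
      x 3 ^ 2)) * hI
  · ring
  · linear_combination ((2 * (x 0 * x 1 + x 2 * x 3)) * (x 0 ^ 2 + x 1 ^ 2 + x 2 ^ 2 +
      x 3 ^ 2)) * hI
  · linear_combination (- (2 * (-(x 0 * x 3) + x 1 * x 2)) * (x 0 ^ 2 + x 1 ^ 2 + x 2 ^ 2 +
      x 3 ^ 2)) * hI
  · ring
  · ring
  · ring
  · linear_combination ((2 * (-(x 0 * x 3) + x 1 * x 2)) * (-x 0 ^ 2 + x 1 ^ 2 - x 2 ^ 2 +
      x 3 ^ 2)) * hI
  · linear_combination ((2 * (x 0 * x 1 + x 2 * x 3)) * (-x 0 ^ 2 + x 1 ^ 2 - x 2 ^ 2 +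
      x 3 ^ 2)) * hI
  · ring
  · ring
  · ring
  · linear_combination ((2 * (-(x 0 * x 3) + x 1 * x 2)) * (2 * (x 0 * x 1 + x 2 * x 3))) * hI
  · ring
  · ring
  · linear_combination ((2 * (-(x 0 * x 3) + x 1 * x 2)) * (2 * (-(x 0 * x 3) + x 1 * x 2)) +
      (-x 0 ^ 2 + x 1 ^ 2 - x 2 ^ 2 + x 3 ^ 2) * (-x 0 ^ 2 + x 1 ^ 2 - x 2 ^ 2 + x 3 ^ 2)) * hI
  · linear_combination ((2 * (x 0 * x 1 + x 2 * x 3)) * (2 * (x 0 * x 1 + x 2 * x 3)) +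
      (-x 0 ^ 2 + x 1 ^ 2 - x 2 ^ 2 + x 3 ^ 2) * (-x 0 ^ 2 + x 1 ^ 2 - x 2 ^ 2 + x 3 ^ 2)) * hI
  · linear_combination ((2 * (-(x 0 * x 3) + x 1 * x 2)) * (2 * (-(x 0 * x 3) + x 1 * x 2)) +
      (2 * (x 0 * x 1 + x 2 * x 3)) * (2 * (x 0 * x 1 + x 2 * x 3))) * hI
  · linear_combination ((x 0 ^ 2 + x 1 ^ 2 + x 2 ^ 2 + x 3 ^ 2) * (x 0 ^ 2 + x 1 ^ 2 + x 2 ^ 2 +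
      x 3 ^ 2)) * hI
  · linear_combination ((x 0 ^ 2 + x 1 ^ 2 + x 2 ^ 2 + x 3 ^ 2) * (x 0 ^ 2 + x 1 ^ 2 + x 2 ^ 2 +
      x 3 ^ 2)) * hI

/-- Rescaling `f_ij` to `f_ij T_i T_j` and `1` to `T_k⁻²` multiplies each relation by a monomial
in the `T_k`. -/
lemma relR'_mul {A : Type} [CommRing A] (f : Edge → A) (T u : Fin 5 → A)
    (hT : ∀ k, T k ^ 2 * u k = 1) (hf : ∀ n, relR' f (fun _ => 1) n = 0) (n : Fin 20) :
    relR' (fun e => f e * T e.fst * T e.snd) u n = 0 := by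
  have h := hf n
  fin_cases n <;> simp only [relR', Edge.fst, Edge.snd, Matrix.cons_val, Fin.isValue, Fin.mk_one,
      Fin.zero_eta, Fin.reduceFinMk] at h ⊢
  · linear_combination (T 1 * T 4 * T 2 * T 3) * h
  · linear_combination (T 0 * T 4 * T 2 * T 3) * h
  · linear_combination (T 0 * T 4 * T 1 * T 3) * h
  · linear_combination (T 0 * T 4 * T 1 * T 2) * h
  · linear_combination (T 0 * T 3 * T 1 * T 2) * h
  · linear_combination (T 0 * T 1) * h + f e02 * f e12 * T 0 * T 1 * hT 2 -
      f e03 * f e13 * T 0 * T 1 * hT 3 + f e04 * f e14 * T 0 * T 1 * hT 4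
  · linear_combination (T 0 * T 4) * h + f e01 * f e14 * T 0 * T 4 * hT 1 -
      f e02 * f e24 * T 0 * T 4 * hT 2 + f e03 * f e34 * T 0 * T 4 * hT 3
  · linear_combination (T 0 * T 3) * h + f e01 * f e13 * T 0 * T 3 * hT 1 +
      f e02 * f e23 * T 0 * T 3 * hT 2 + f e04 * f e34 * T 0 * T 3 * hT 4
  · linear_combination (T 0 * T 2) * h + f e01 * f e12 * T 0 * T 2 * hT 1 +
      f e03 * f e23 * T 0 * T 2 * hT 3 + f e04 * f e24 * T 0 * T 2 * hT 4
  · linear_combination (T 3 * T 4) * h + f e03 * f e04 * T 3 * T 4 * hT 0 -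
      f e13 * f e14 * T 3 * T 4 * hT 1 + f e23 * f e24 * T 3 * T 4 * hT 2
  · linear_combination (T 2 * T 4) * h + f e02 * f e04 * T 2 * T 4 * hT 0 +
      f e12 * f e14 * T 2 * T 4 * hT 1 + f e23 * f e34 * T 2 * T 4 * hT 3
  · linear_combination (T 1 * T 4) * h + f e01 * f e04 * T 1 * T 4 * hT 0 +
      f e12 * f e24 * T 1 * T 4 * hT 2 + f e13 * f e34 * T 1 * T 4 * hT 3
  · linear_combination (T 2 * T 3) * h + f e02 * f e03 * T 2 * T 3 * hT 0 -
      f e12 * f e13 * T 2 * T 3 * hT 1 - f e24 * f e34 * T 2 * T 3 * hT 4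
  · linear_combination (T 1 * T 3) * h + f e01 * f e03 * T 1 * T 3 * hT 0 +
      f e12 * f e23 * T 1 * T 3 * hT 2 + f e14 * f e34 * T 1 * T 3 * hT 4
  · linear_combination (T 1 * T 2) * h + f e01 * f e02 * T 1 * T 2 * hT 0 +
      f e13 * f e23 * T 1 * T 2 * hT 3 - f e14 * f e24 * T 1 * T 2 * hT 4
  · linear_combination (T 2 * T 2) * h + f e02 * f e02 * T 2 * T 2 * hT 0 +
      f e12 * f e12 * T 2 * T 2 * hT 1 + f e23 * f e23 * T 2 * T 2 * hT 3 +
      f e24 * f e24 * T 2 * T 2 * hT 4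
  · linear_combination (T 3 * T 3) * h + f e03 * f e03 * T 3 * T 3 * hT 0 +
      f e13 * f e13 * T 3 * T 3 * hT 1 + f e23 * f e23 * T 3 * T 3 * hT 2 +
      f e34 * f e34 * T 3 * T 3 * hT 4
  · linear_combination (T 0 * T 0) * h + f e01 * f e01 * T 0 * T 0 * hT 1 +
      f e02 * f e02 * T 0 * T 0 * hT 2 + f e03 * f e03 * T 0 * T 0 * hT 3 +
      f e04 * f e04 * T 0 * T 0 * hT 4
  · linear_combination (T 4 * T 4) * h + f e04 * f e04 * T 4 * T 4 * hT 0 +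
      f e14 * f e14 * T 4 * T 4 * hT 1 + f e24 * f e24 * T 4 * T 4 * hT 2 +
      f e34 * f e34 * T 4 * T 4 * hT 3
  · linear_combination (T 1 * T 1) * h + f e01 * f e01 * T 1 * T 1 * hT 0 +
      f e12 * f e12 * T 1 * T 1 * hT 2 + f e13 * f e13 * T 1 * T 1 * hT 3 +
      f e14 * f e14 * T 1 * T 1 * hT 4

/-! ### The relations hold in `R'` and `R` -/

/-- `const` as a ring homomorphism. -/
def constHom (σ : Type) : MvPolynomial (Fin 4) ℂ →+* Laurent σ :=
  AddMonoidAlgebra.singleZeroRingHom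

lemma tpow_mul_tpow {σ : Type} [DecidableEq σ] (k : σ) (m n : ℤ) :
    tpow k m * tpow k n = tpow k (m + n) := by
  simp [tpow, AddMonoidAlgebra.single_mul_single, Pi.single_add]

lemma tpow_zero {σ : Type} [DecidableEq σ] (k : σ) : tpow k 0 = 1 := by
  simp [tpow, AddMonoidAlgebra.one_def]

lemma map_relR' {A B : Type} [CommRing A] [CommRing B] (g : A →+* B) (w : Edge → A)
    (u : Fin 5 → A) (n : Fin 20) :
    g (relR' w u n) = relR' (fun e => g (w e)) (fun k => g (u k)) n := by
  fin_cases n <;> simp [relR']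

lemma coe_Phi_X_inl (e : Edge) : (Phi (X (Sum.inl e))).1 = phiBar' e := by
  simp [Phi]

lemma coe_Phi_X_inr (k : Fin 5) : (Phi (X (Sum.inr k))).1 = tpow k (-2) := by
  simp [Phi]

lemma Phi_gen' (n : Fin 20) : Phi (gen' n) = 0 := by
  have h : (R'.val.comp Phi : _ →+* Laurent (Fin 5)) (gen' n) = 0 := by
    rw [gen', map_relR']
    refine Eq.trans ?_ (relR'_mul (fun e => constHom _ (phi e)) (fun k => tpow k 1)
      (fun k => tpow k (-2)) ?_ ?_ n)
    · congr 1
      · funext e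
        exact coe_Phi_X_inl e
      · funext k
        exact coe_Phi_X_inr k
    · intro k
      rw [sq, tpow_mul_tpow, tpow_mul_tpow]
      exact tpow_zero k
    · intro n
      simpa [map_relR'] using congrArg (constHom (Fin 5)) (relR'_phi n)
  exact Subtype.ext h

lemma relR'_eq_relR {A : Type} [CommRing A] (w : Edge → A) (u : Fin 5 → A)
    (h1 : u 1 = 1) (h3 : u 3 = 1) (h4 : u 4 = 1) (n : Fin 20) :
    relR' w u n = relR w (u 0) (u 2) n := by
  fin_cases n <;> simp [relR, relR', h1, h3, h4]

lemma subst_X_inl (e : Edge) : subst (X (Sum.inl e)) = X (Sum.inl e) :=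
  aeval_X _ _

lemma subst_X_inr (k : Fin 5) :
    subst (X (Sum.inr k)) = if h : k = 0 ∨ k = 2 then X (Sum.inr ⟨k, h⟩) else 1 :=
  aeval_X _ _

lemma subst_gen' (n : Fin 20) : subst (gen' n) = gen n := by
  have h := map_relR' (subst : MvPolynomial (Edge ⊕ Fin 5) ℂ →+* MvPolynomial (Edge ⊕ K) ℂ)
    (fun e => X (Sum.inl e)) (fun k => X (Sum.inr k)) n
  refine h.trans ?_
  rw [relR'_eq_relR]
  · simp only [RingHom.coe_coe, subst_X_inl, subst_X_inr]
    rfl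
  all_goals simp [subst_X_inr]

lemma coe_Psi_X_inl (e : Edge) : (Psi (X (Sum.inl e))).1 = phiBar e :=
  congrArg Subtype.val (aeval_X _ _)

lemma coe_Psi_X_inr (k : K) : (Psi (X (Sum.inr k))).1 = tpow k (-2) :=
  congrArg Subtype.val (aeval_X _ _)

lemma Psi_subst (f : MvPolynomial (Edge ⊕ Fin 5) ℂ) : Psi (subst f) = resR (Phi f) := by
  suffices h : Psi.comp subst = resR.comp Phi from DFunLike.congr_fun h f
  refine MvPolynomial.algHom_ext ?_
  rintro (e | k)
  · refine Subtype.ext ?_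
    change (Psi (subst (X (Sum.inl e)))).1 = specT (Phi (X (Sum.inl e))).1
    rw [coe_Phi_X_inl, specT_phiBar', subst_X_inl, coe_Psi_X_inl]
  · refine Subtype.ext ?_
    change (Psi (subst (X (Sum.inr k)))).1 = specT (Phi (X (Sum.inr k))).1
    rw [coe_Phi_X_inr, specT_tpow, subst_X_inr]
    split_ifs with h
    · exact coe_Psi_X_inr _
    · rw [map_one]
      rfl

lemma Psi_gen (n : Fin 20) : Psi (gen n) = 0 := by
  rw [← subst_gen', Psi_subst, Phi_gen', map_zero]

/-! ### Surjectivity, and the kernel of the substitution -/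

/-- A homomorphism to a subalgebra is surjective if its values at the variables include a set of
generators. -/
lemma surjective_of_subset_range_X {τ A : Type} [CommRing A] [Algebra ℂ A] {S : Set A}
    (F : MvPolynomial τ ℂ →ₐ[ℂ] Algebra.adjoin ℂ S) (h : S ⊆ Set.range fun i => (F (X i)).1) :
    Function.Surjective F := by
  rintro ⟨y, hy⟩
  have hle : Algebra.adjoin ℂ S ≤ ((Algebra.adjoin ℂ S).val.comp F).range := by
    refine Algebra.adjoin_le fun s hs => ?_
    obtain ⟨i, rfl⟩ := h hs
    exact ⟨X i, rfl⟩
  obtain ⟨p, hp⟩ := hle hy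
  exact ⟨p, Subtype.ext hp⟩

lemma Phi_surjective : Function.Surjective Phi := by
  refine surjective_of_subset_range_X Phi ?_
  rintro _ (⟨e, rfl⟩ | ⟨k, rfl⟩)
  · exact ⟨Sum.inl e, coe_Phi_X_inl e⟩
  · exact ⟨Sum.inr k, coe_Phi_X_inr k⟩

lemma Psi_surjective : Function.Surjective Psi := by
  refine surjective_of_subset_range_X Psi ?_
  rintro _ (⟨e, rfl⟩ | ⟨k, rfl⟩)
  · exact ⟨Sum.inl e, coe_Psi_X_inl e⟩
  · exact ⟨Sum.inr k, coe_Psi_X_inr k⟩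

/-- The inclusion `ℂ[w_ij, u₀, u₂] → ℂ[w_ij, u₀, …, u₄]`, a section of `subst`. -/
def substSection : MvPolynomial (Edge ⊕ K) ℂ →ₐ[ℂ] MvPolynomial (Edge ⊕ Fin 5) ℂ :=
  rename (Sum.map id Subtype.val)

lemma subst_substSection (f : MvPolynomial (Edge ⊕ K) ℂ) : subst (substSection f) = f := by
  suffices h : subst.comp substSection = AlgHom.id ℂ _ from DFunLike.congr_fun h f
  refine MvPolynomial.algHom_ext ?_
  rintro (e | k)
  · simp [subst, substSection]
  · simp [subst, substSection, k.2]

lemma subst_surjective : Function.Surjective subst := fun f => ⟨_, subst_substSection f⟩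

lemma ker_subst : RingHom.ker subst = Ideal.span
    {X (Sum.inr 1) - 1, X (Sum.inr 3) - 1, X (Sum.inr 4) - 1} := by
  refine le_antisymm (fun f hf => ?_) (Ideal.span_le.2 ?_)
  · set J : Ideal (MvPolynomial (Edge ⊕ Fin 5) ℂ) := Ideal.span
      {X (Sum.inr 1) - 1, X (Sum.inr 3) - 1, X (Sum.inr 4) - 1} with hJ
    have key : ((Ideal.Quotient.mkₐ ℂ J).comp substSection).comp subst =
        Ideal.Quotient.mkₐ ℂ J := by
      refine MvPolynomial.algHom_ext ?_
      rintro (e | k)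
      · simp [subst, substSection]
      · by_cases hk : k = 0 ∨ k = 2
        · simp [subst, substSection, hk]
        · have hmem : (X (Sum.inr k) - 1 : MvPolynomial (Edge ⊕ Fin 5) ℂ) ∈ J := by
            refine Ideal.subset_span ?_
            fin_cases k <;> simp at hk ⊢
          have := (Ideal.Quotient.eq (I := J)).2 hmem
          simp only [AlgHom.comp_apply, subst, aeval_X, Sum.elim_inr, hk, dif_neg,
            not_false_eq_true, map_one]
          simpa using this.symm
    have h := DFunLike.congr_fun key f
    rw [AlgHom.comp_apply, (RingHom.mem_ker).1 hf, map_zero] at h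
    exact Ideal.Quotient.eq_zero_iff_mem.1 h.symm
  · rintro _ (rfl | rfl | rfl) <;> simp [subst]

/-! ### Leading monomials and standard monomials -/

/-- The variables `w_ij`, `u_k` of the presentation of `R'`. -/
abbrev Var : Type := Edge ⊕ Fin 5

/-- The variable `w_ij`. -/
abbrev w (e : Edge) : Var := Sum.inl e

/-- The variable `u_k`. -/
abbrev u (k : Fin 5) : Var := Sum.inr k

/-- The leading monomials, as lists of variables: for `n < 20` the leading term of the `n`-th
relation, and for `n = 20` that of a further element of the ideal of the relations. -/
def lead : Fin 21 → List Var :=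
  ![[w e14, w e23],
    [w e03, w e24],
    [w e03, w e14],
    [w e04, w e12],
    [w e03, w e12],
    [w e03, w e13, u 3],
    [w e03, w e34, u 3],
    [w e04, w e34, u 4],
    [w e03, w e23, u 3],
    [w e23, w e24, u 2],
    [w e23, w e34, u 3],
    [w e13, w e34, u 3],
    [w e24, w e34, u 4],
    [w e14, w e34, u 4],
    [w e13, w e23, u 3],
    [w e23, w e23, u 3],
    [w e23, w e23, u 2],
    [w e03, w e03, u 3],
    [w e24, w e24, u 2],
    [w e13, w e13, u 3],
    [w e34, w e34, u 3, u 4]]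

/-- The combination of monomials to which the leading monomial `lead n` is congruent modulo the
relations. -/
def tail : Fin 21 → List (ℤ × List Var) :=
  ![[(-1, [w e13, w e24]), (1, [w e12, w e34])],
    [(1, [w e04, w e23]), (-1, [w e02, w e34])],
    [(-1, [w e04, w e13]), (1, [w e01, w e34])],
    [(1, [w e02, w e14]), (1, [w e01, w e24])],
    [(-1, [w e02, w e13]), (1, [w e01, w e23])],
    [(1, [w e02, w e12, u 2]), (1, [w e04, w e14, u 4])],
    [(-1, [w e01, w e14, u 1]), (1, [w e02, w e24, u 2])],
    [(-1, [w e01, w e13, u 1]), (-1, [w e02, w e23, u 2])],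
    [(-1, [w e01, w e12, u 1]), (-1, [w e04, w e24, u 4])],
    [(-1, [w e03, w e04, u 0]), (1, [w e13, w e14, u 1])],
    [(-1, [w e02, w e04, u 0]), (-1, [w e12, w e14, u 1])],
    [(-1, [w e01, w e04, u 0]), (-1, [w e12, w e24, u 2])],
    [(1, [w e02, w e03, u 0]), (-1, [w e12, w e13, u 1])],
    [(-1, [w e01, w e03, u 0]), (-1, [w e12, w e23, u 2])],
    [(-1, [w e01, w e02, u 0]), (1, [w e14, w e24, u 4])],
    [(-1, [w e02, w e02, u 0]), (-1, [w e12, w e12, u 1]), (-1, [w e24, w e24, u 4])],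
    [(-1, [w e03, w e03, u 0]), (-1, [w e13, w e13, u 1]), (-1, [w e34, w e34, u 4])],
    [(-1, [w e01, w e01, u 1]), (-1, [w e02, w e02, u 2]), (-1, [w e04, w e04, u 4])],
    [(-1, [w e04, w e04, u 0]), (-1, [w e14, w e14, u 1]), (-1, [w e34, w e34, u 3])],
    [(-1, [w e01, w e01, u 0]), (-1, [w e12, w e12, u 2]), (-1, [w e14, w e14, u 4])],
    [(1, [w e12, w e12, u 1, u 2]), (1, [w e01, w e01, u 0, u 1]), (1, [w e02, w e02, u 0, u 2])]]

/-- The exponent vector of a product of variables. -/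
def expo (l : List Var) : Var →₀ ℕ := (l.map fun i => Finsupp.single i 1).sum

/-- A monomial is standard if it is divisible by none of the leading monomials. -/
def IsStandard (s : Var →₀ ℕ) : Prop := ∀ n, ¬ expo (lead n) ≤ s

lemma expo_nil : expo [] = 0 := rfl

lemma expo_cons (i : Var) (l : List Var) : expo (i :: l) = Finsupp.single i 1 + expo l := by
  simp [expo]

lemma expo_cons_le_iff (i : Var) (l : List Var) (s : Var →₀ ℕ) :
    expo (i :: l) ≤ s ↔ s i ≠ 0 ∧ expo l ≤ s - Finsupp.single i 1 := by
  have h : s i ≠ 0 ↔ Finsupp.single i 1 ≤ s := by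
    rw [Finsupp.single_le_iff, Nat.one_le_iff_ne_zero]
  rw [expo_cons, h]
  refine ⟨fun hs => ?_, fun hs => ?_⟩
  · have h1 := le_self_add.trans hs
    exact ⟨h1, (le_tsub_iff_left h1).2 hs⟩
  · exact (le_tsub_iff_left hs.1).1 hs.2

/-- The conditions on the exponents `n` of the `w_ij` and `u` of the `u_k` which say that none of
the leading monomials divides the monomial; each field is named after a leading monomial. -/
structure LeadFree (n : Edge → ℕ) (u : Fin 5 → ℕ) : Prop where
  w03_w12 : n e03 = 0 ∨ n e12 = 0
  w04_w12 : n e04 = 0 ∨ n e12 = 0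
  w03_w14 : n e03 = 0 ∨ n e14 = 0
  w03_w24 : n e03 = 0 ∨ n e24 = 0
  w14_w23 : n e14 = 0 ∨ n e23 = 0
  w23_w34_u3 : n e23 = 0 ∨ n e34 = 0 ∨ u 3 = 0
  w24_w34_u4 : n e24 = 0 ∨ n e34 = 0 ∨ u 4 = 0
  w13_w34_u3 : n e13 = 0 ∨ n e34 = 0 ∨ u 3 = 0
  w14_w34_u4 : n e14 = 0 ∨ n e34 = 0 ∨ u 4 = 0
  w03_w34_u3 : n e03 = 0 ∨ n e34 = 0 ∨ u 3 = 0
  w04_w34_u4 : n e04 = 0 ∨ n e34 = 0 ∨ u 4 = 0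
  w03_w23_u3 : n e03 = 0 ∨ n e23 = 0 ∨ u 3 = 0
  w03_w13_u3 : n e03 = 0 ∨ n e13 = 0 ∨ u 3 = 0
  w03_sq_u3 : n e03 ≤ 1 ∨ u 3 = 0
  w23_w24_u2 : n e23 = 0 ∨ n e24 = 0 ∨ u 2 = 0
  w24_sq_u2 : n e24 ≤ 1 ∨ u 2 = 0
  w23_sq_u2 : n e23 ≤ 1 ∨ u 2 = 0
  w13_w23_u3 : n e13 = 0 ∨ n e23 = 0 ∨ u 3 = 0
  w23_sq_u3 : n e23 ≤ 1 ∨ u 3 = 0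
  w13_sq_u3 : n e13 ≤ 1 ∨ u 3 = 0
  w34_sq_u3_u4 : n e34 ≤ 1 ∨ u 3 = 0 ∨ u 4 = 0

lemma IsStandard.leadFree {s : Var →₀ ℕ} (hs : IsStandard s) :
    LeadFree (fun e => s (w e)) (fun k => s (u k)) := by
  constructor
  · have := hs 4
    simp [lead, expo_cons_le_iff, expo_nil] at this
    omega
  · have := hs 3
    simp [lead, expo_cons_le_iff, expo_nil] at this
    omega
  · have := hs 2
    simp [lead, expo_cons_le_iff, expo_nil] at this
    omega
  · have := hs 1
    simp [lead, expo_cons_le_iff, expo_nil] at this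
    omega
  · have := hs 0
    simp [lead, expo_cons_le_iff, expo_nil] at this
    omega
  · have := hs 10
    simp [lead, expo_cons_le_iff, expo_nil] at this
    omega
  · have := hs 12
    simp [lead, expo_cons_le_iff, expo_nil] at this
    omega
  · have := hs 11
    simp [lead, expo_cons_le_iff, expo_nil] at this
    omega
  · have := hs 13
    simp [lead, expo_cons_le_iff, expo_nil] at this
    omega
  · have := hs 6
    simp [lead, expo_cons_le_iff, expo_nil] at this
    omega
  · have := hs 7
    simp [lead, expo_cons_le_iff, expo_nil] at this
    omega
  · have := hs 8
    simp [lead, expo_cons_le_iff, expo_nil] at this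
    omega
  · have := hs 5
    simp [lead, expo_cons_le_iff, expo_nil] at this
    omega
  · have := hs 17
    simp [lead, expo_cons_le_iff, expo_nil] at this
    omega
  · have := hs 9
    simp [lead, expo_cons_le_iff, expo_nil] at this
    omega
  · have := hs 18
    simp [lead, expo_cons_le_iff, expo_nil] at this
    omega
  · have := hs 16
    simp [lead, expo_cons_le_iff, expo_nil] at this
    omega
  · have := hs 14
    simp [lead, expo_cons_le_iff, expo_nil] at this
    omega
  · have := hs 15
    simp [lead, expo_cons_le_iff, expo_nil] at this
    omega
  · have := hs 19
    simp [lead, expo_cons_le_iff, expo_nil] at this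
    omega
  · have := hs 20
    simp [lead, expo_cons_le_iff, expo_nil] at this
    omega

/-- Two monomials, with exponents `n, u` and `m, v`, have the same degree in `t₀, …, t₄`, and the
leading monomials of their images in `ℂ[a, b, c, e]` coincide. -/
structure SameDegree (n : Edge → ℕ) (u : Fin 5 → ℕ) (m : Edge → ℕ) (v : Fin 5 → ℕ) : Prop where
  a : 4 * (n e13 + n e14 + n e23 + n e24) + 3 * (n e12 + n e34 + n e03 + n e04) +
      2 * (n e01 + n e02) =
    4 * (m e13 + m e14 + m e23 + m e24) + 3 * (m e12 + m e34 + m e03 + m e04) +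
      2 * (m e01 + m e02)
  b : n e12 + n e34 + n e02 = m e12 + m e34 + m e02
  c : n e03 + n e04 + n e02 = m e03 + m e04 + m e02
  e : n e01 = m e01
  t0 : n e01 + n e02 + n e03 + n e04 + 2 * v 0 = m e01 + m e02 + m e03 + m e04 + 2 * u 0
  t1 : n e01 + n e12 + n e13 + n e14 + 2 * v 1 = m e01 + m e12 + m e13 + m e14 + 2 * u 1
  t2 : n e02 + n e12 + n e23 + n e24 + 2 * v 2 = m e02 + m e12 + m e23 + m e24 + 2 * u 2
  t3 : n e03 + n e13 + n e23 + n e34 + 2 * v 3 = m e03 + m e13 + m e23 + m e34 + 2 * u 3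
  t4 : n e04 + n e14 + n e24 + n e34 + 2 * v 4 = m e04 + m e14 + m e24 + m e34 + 2 * u 4

lemma left_of_or_or {a b c : Prop} (h : a ∨ b ∨ c) (hb : ¬ b) (hc : ¬ c) : a := by tauto

/-- A number `r - 2 a` determines `r` and `a` if `r ≤ 1` or `a = 0`. -/
lemma eq_and_eq_of_add_two_mul {r r' a a' : ℕ} (h : r + 2 * a' = r' + 2 * a)
    (ha : a = 0 ∨ r ≤ 1) (ha' : a' = 0 ∨ r' ≤ 1) : r = r' ∧ a = a' := by
  omega

section

variable {n m : Edge → ℕ} {u v : Fin 5 → ℕ}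

lemma SameDegree.symm (f : SameDegree n u m v) : SameDegree m v n u :=
  ⟨f.a.symm, f.b.symm, f.c.symm, f.e.symm, f.t0.symm, f.t1.symm, f.t2.symm, f.t3.symm, f.t4.symm⟩

/-- If fewer factors `w₀₂` occur in the first monomial, then more of `w₀₃, w₀₄` and of `w₁₂, w₃₄`
occur in it; then the leading monomials exclude `w₁₂`, and the degrees in `t₃, t₄` are too
large. -/
lemma SameDegree.le_e02 (f : SameDegree n u m v) (h : LeadFree n u) : m e02 ≤ n e02 := by
  obtain ⟨a, b, c, e, t0, t1, t2, t3, t4⟩ := f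
  by_contra hh
  have hc : n e03 + n e04 ≠ 0 := by omega
  have p12 : n e12 = 0 := by
    rcases h.w03_w12 with h0 | h0
    · exact h.w04_w12.resolve_left (by omega)
    · exact h0
  have p34 : n e34 ≠ 0 := by omega
  by_cases h3 : u 3 = 0
  · by_cases h4 : u 4 = 0
    · omega
    · have := left_of_or_or h.w24_w34_u4 p34 h4
      have := left_of_or_or h.w14_w34_u4 p34 h4
      have := left_of_or_or h.w04_w34_u4 p34 h4
      omega
  · have := left_of_or_or h.w23_w34_u3 p34 h3
    have := left_of_or_or h.w13_w34_u3 p34 h3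
    have := left_of_or_or h.w03_w34_u3 p34 h3
    have : u 4 = 0 := by
      by_contra h4
      have := left_of_or_or h.w04_w34_u4 p34 h4
      omega
    omega

lemma SameDegree.le_e03 (f : SameDegree n u m v) (h : LeadFree n u) (k : LeadFree m v)
    (e02 : n e02 = m e02) : m e03 ≤ n e03 := by
  obtain ⟨a, b, c, e, t0, t1, t2, t3, t4⟩ := f
  by_contra hh
  have p03 : m e03 ≠ 0 := by omega
  have p04 : n e04 ≠ 0 := by omega
  have := h.w04_w12.resolve_left p04
  have := k.w03_w12.resolve_left p03
  have := k.w03_w14.resolve_left p03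
  have := k.w03_w24.resolve_left p03
  by_cases h3 : v 3 = 0
  · omega
  · have := (or_assoc.2 k.w03_w34_u3).resolve_right h3 |>.resolve_left p03
    have := (or_assoc.2 k.w03_w23_u3).resolve_right h3 |>.resolve_left p03
    have := (or_assoc.2 k.w03_w13_u3).resolve_right h3 |>.resolve_left p03
    have := k.w03_sq_u3.resolve_right h3
    omega

lemma SameDegree.le_e12 (f : SameDegree n u m v) (h : LeadFree n u) (k : LeadFree m v)
    (e02 : n e02 = m e02) (e03 : n e03 = m e03) : m e12 ≤ n e12 := by
  by_contra hh
  have p12 : m e12 ≠ 0 := by omega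
  have m3 := k.w03_w12.resolve_right p12
  have m4 := k.w04_w12.resolve_right p12
  have n4 : n e04 = 0 := by have := f.c; omega
  have hlt : m e34 < n e34 := by have := f.b; omega
  have p34 : n e34 ≠ 0 := by omega
  have hp : n e13 + n e14 + n e23 + n e24 = m e13 + m e14 + m e23 + m e24 := by
    have := f.a
    have := f.b
    have := f.e
    omega
  have t3 := f.t3
  have t4 := f.t4
  clear f
  by_cases h3 : u 3 = 0
  · by_cases h4 : u 4 = 0
    · omega
    · have := left_of_or_or h.w24_w34_u4 p34 h4
      have := left_of_or_or h.w14_w34_u4 p34 h4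
      omega
  · have := left_of_or_or h.w23_w34_u3 p34 h3
    have := left_of_or_or h.w13_w34_u3 p34 h3
    by_cases h4 : u 4 = 0
    · omega
    · have := left_of_or_or h.w24_w34_u4 p34 h4
      have := left_of_or_or h.w14_w34_u4 p34 h4
      have := left_of_or_or h.w34_sq_u3_u4 h3 h4
      omega

lemma LeadFree.u2_eq_zero_or (h : LeadFree n u) : u 2 = 0 ∨ n e23 + n e24 ≤ 1 := by
  have := h.w23_w24_u2
  have := h.w24_sq_u2
  have := h.w23_sq_u2
  omega

lemma LeadFree.u3_eq_zero_or (h : LeadFree n u) : u 3 = 0 ∨ n e13 + n e23 ≤ 1 := by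
  have := h.w13_w23_u3
  have := h.w23_sq_u3
  have := h.w13_sq_u3
  omega

/-- A monomial that no leading monomial divides is determined by its degrees. -/
lemma SameDegree.eq (f : SameDegree n u m v) (h : LeadFree n u) (k : LeadFree m v) :
    n = m ∧ u = v := by
  have e02 := le_antisymm (f.symm.le_e02 k) (f.le_e02 h)
  have e03 := le_antisymm (f.symm.le_e03 k h e02.symm) (f.le_e03 h k e02)
  have e12 := le_antisymm (f.symm.le_e12 k h e02.symm e03.symm) (f.le_e12 h k e02 e03)
  have e01 := f.e
  have e34 : n e34 = m e34 := by have := f.b; omega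
  have e04 : n e04 = m e04 := by have := f.c; omega
  have hp : n e13 + n e14 + n e23 + n e24 = m e13 + m e14 + m e23 + m e24 := by
    have := f.a
    omega
  obtain ⟨h2, u2⟩ := eq_and_eq_of_add_two_mul (r := n e23 + n e24) (r' := m e23 + m e24)
    (by have := f.t2; omega) h.u2_eq_zero_or k.u2_eq_zero_or
  obtain ⟨h3, u3⟩ := eq_and_eq_of_add_two_mul (r := n e13 + n e23) (r' := m e13 + m e23)
    (by have := f.t3; omega) h.u3_eq_zero_or k.u3_eq_zero_or
  have e23 : n e23 = m e23 := by
    have := h.w14_w23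
    have := k.w14_w23
    omega
  have e13 : n e13 = m e13 := by omega
  have e24 : n e24 = m e24 := by omega
  have e14 : n e14 = m e14 := by omega
  have u0 : u 0 = v 0 := by have := f.t0; omega
  have u1 : u 1 = v 1 := by have := f.t1; omega
  have u4 : u 4 = v 4 := by have := f.t4; omega
  refine ⟨?_, ?_⟩
  · funext e
    cases e <;> assumption
  · funext k
    fin_cases k <;> assumption

end

/-! ### Standard monomials span modulo the relations -/

/-- Weights of the variables for which each leading monomial is heavier than the other terms of
its relation. -/
def wt : Var → ℕ
  | .inl e01 => 0 | .inl e02 => 2 | .inl e03 => 7 | .inl e04 => 5 | .inl e12 => 3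
  | .inl e13 => 5 | .inl e14 => 5 | .inl e23 => 8 | .inl e24 => 7 | .inl e34 => 5
  | .inr k => ![1, 1, 0, 3, 2] k

lemma weight_expo {M : Type} [AddCommMonoid M] (f : Var → M) (l : List Var) :
    Finsupp.weight f (expo l) = (l.map f).sum := by
  induction l with
  | nil => simp [expo_nil]
  | cons i l ih => simp [expo_cons, ih, Finsupp.weight_single]

lemma weight_tail_lt (n : Fin 21) :
    ∀ p ∈ tail n, Finsupp.weight wt (expo p.2) < Finsupp.weight wt (expo (lead n)) := by
  simp only [weight_expo]
  revert n
  decide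

lemma monomial_expo (l : List Var) :
    (monomial (expo l) 1 : MvPolynomial Var ℂ) = (l.map X).prod := by
  induction l with
  | nil => simp [expo_nil]
  | cons i l ih => rw [expo_cons, List.map_cons, List.prod_cons, ← ih, X, monomial_mul, one_mul]

/-- The sign with which the leading monomial occurs in the `n`-th relation. -/
def leadSign : Fin 20 → ℤ := ![1, -1, 1, 1, 1, -1, 1, 1, 1, 1, 1, 1, -1, 1, 1, 1, 1, 1, 1, 1]

lemma lead_sub_tail_castSucc {A : Type} [CommRing A] (x : Var → A) (n : Fin 20) :
    ((lead n.castSucc).map x).prod -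
      ((tail n.castSucc).map fun p => p.1 • (p.2.map x).prod).sum =
    leadSign n * relR' (fun e => x (w e)) (fun k => x (u k)) n := by
  fin_cases n <;>
  · simp only [lead, tail, leadSign, relR', Matrix.cons_val, Fin.isValue, Fin.mk_one,
      Fin.zero_eta, Fin.reduceFinMk, Fin.castSucc_zero, Fin.castSucc_one, Fin.reduceCastSucc,
      List.map_cons, List.map_nil, List.prod_cons, List.prod_nil, List.sum_cons, List.sum_nil,
      neg_smul, one_smul, Int.cast_one, Int.cast_neg]
    ring

/-- The relation with leading monomial `w₃₄² u₃ u₄` comes from adding the relations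
`Σ_j w_ij² u_j = 0`, multiplied by `u_i`, with signs `+, +, +, -, -` for `i = 0, 1, 2, 3, 4`. -/
lemma two_mul_lead_sub_tail_last {A : Type} [CommRing A] (x : Var → A) :
    -2 * (((lead 20).map x).prod - ((tail 20).map fun p => p.1 • (p.2.map x).prod).sum) =
      x (u 0) * relR' (fun e => x (w e)) (fun k => x (u k)) 17 +
      x (u 1) * relR' (fun e => x (w e)) (fun k => x (u k)) 19 +
      x (u 2) * relR' (fun e => x (w e)) (fun k => x (u k)) 15 -
      x (u 3) * relR' (fun e => x (w e)) (fun k => x (u k)) 16 -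
      x (u 4) * relR' (fun e => x (w e)) (fun k => x (u k)) 18 := by
  simp only [lead, tail, relR', Matrix.cons_val, Fin.isValue, List.map_cons, List.map_nil,
    List.prod_cons, List.prod_nil, List.sum_cons, List.sum_nil, one_smul]
  ring

lemma lead_sub_tail_mem (n : Fin 21) :
    (monomial (expo (lead n)) 1 - ((tail n).map fun p => p.1 • monomial (expo p.2) 1).sum :
      MvPolynomial Var ℂ) ∈ Ideal.span (Set.range gen') := by
  set I : Ideal (MvPolynomial Var ℂ) := Ideal.span (Set.range gen')
  have hg (n : Fin 20) : relR' (fun e => X (w e)) (fun k => X (u k)) n ∈ I :=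
    Ideal.subset_span ⟨n, rfl⟩
  simp only [monomial_expo]
  induction n using Fin.lastCases with
  | last =>
    have h : (C (-1 / 2) : MvPolynomial Var ℂ) * -2 = 1 := by
      rw [show (-2 : MvPolynomial Var ℂ) = C (-2) by rw [C_neg, map_ofNat], ← C_mul]
      norm_num
    rw [← one_mul (_ - _), ← h, mul_assoc]
    refine I.mul_mem_left _ ?_
    refine (two_mul_lead_sub_tail_last (X : Var → MvPolynomial Var ℂ)).symm ▸ ?_
    exact I.sub_mem (I.sub_mem (I.add_mem (I.add_mem (I.mul_mem_left _ (hg _))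
      (I.mul_mem_left _ (hg _))) (I.mul_mem_left _ (hg _))) (I.mul_mem_left _ (hg _)))
      (I.mul_mem_left _ (hg _))
  | cast n =>
    rw [lead_sub_tail_castSucc]
    exact I.mul_mem_left _ (hg n)

/-- Modulo the ideal of the relations every polynomial is a combination of standard monomials. -/
lemma exists_standard_sub_mem (f : MvPolynomial Var ℂ) :
    ∃ r ∈ restrictSupport ℂ {s | IsStandard s}, f - r ∈ Ideal.span (Set.range gen') := by
  set I : Ideal (MvPolynomial Var ℂ) := Ideal.span (Set.range gen') with hI
  set W : Submodule ℂ (MvPolynomial Var ℂ) :=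
    I.restrictScalars ℂ ⊔ restrictSupport ℂ {s | IsStandard s} with hW
  have key : ∀ (N : ℕ) (s : Var →₀ ℕ), Finsupp.weight wt s = N →
      (monomial s 1 : MvPolynomial Var ℂ) ∈ W := by
    intro N
    induction N using Nat.strong_induction_on with
    | _ N ih =>
      intro s hs
      by_cases hst : IsStandard s
      · refine Submodule.mem_sup_right ?_
        rw [mem_restrictSupport_iff]
        exact (Finset.coe_subset.2 support_monomial_subset).trans (by simpa using hst)
      · simp only [IsStandard, not_forall, not_not] at hst
        obtain ⟨n, hn⟩ := hst
        obtain ⟨q, rfl⟩ := exists_add_of_le hn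
        rw [map_add] at hs
        have h1 : (monomial (expo (lead n) + q) 1 : MvPolynomial Var ℂ) =
            monomial q 1 * (monomial (expo (lead n)) 1 -
              ((tail n).map fun p => p.1 • monomial (expo p.2) 1).sum) +
            ((tail n).map fun p => p.1 • monomial (expo p.2 + q) 1).sum := by
          have h2 : ((tail n).map fun p => p.1 •
              (monomial (expo p.2 + q) 1 : MvPolynomial Var ℂ)).sum =
              monomial q 1 * ((tail n).map fun p => p.1 • monomial (expo p.2) 1).sum := by
            rw [← List.sum_map_mul_left]
            congr 2
            funext p
            rw [mul_smul_comm, monomial_mul, one_mul, add_comm]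
          rw [h2, mul_sub, monomial_mul, one_mul, add_comm q]
          ring
        rw [h1]
        refine W.add_mem (Submodule.mem_sup_left (I.mul_mem_left _ (lead_sub_tail_mem n))) ?_
        refine list_sum_mem fun y hy => ?_
        obtain ⟨p, hp, rfl⟩ := List.mem_map.1 hy
        refine zsmul_mem (ih _ ?_ _ rfl) _
        have := weight_tail_lt n p hp
        rw [map_add]
        omega
  have hf : f ∈ W := by
    rw [f.as_sum]
    refine W.sum_mem fun s _ => ?_
    rw [← mul_one (coeff s f), ← smul_eq_mul, ← smul_monomial]
    exact W.smul_mem _ (key _ s rfl)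
  obtain ⟨g, hg, r, hr, rfl⟩ := Submodule.mem_sup.1 hf
  exact ⟨r, hr, by simpa using hg⟩

/-! ### Leading exponents of the `φ_ij` in suitable coordinates -/

/-- The exponent vector with entries `v 0, …, v 3`. -/
def vec (v : Fin 4 → ℕ) : Fin 4 →₀ ℕ := Finsupp.equivFunOnFinite.symm v

lemma vec_apply (v : Fin 4 → ℕ) (i : Fin 4) : vec v i = v i := rfl

lemma monomial_vec (v : Fin 4 → ℕ) (c : ℂ) :
    monomial (vec v) c = C c * (X 0 ^ v 0 * X 1 ^ v 1 * X 2 ^ v 2 * X 3 ^ v 3) := by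
  rw [monomial_eq, Finsupp.prod_fintype _ _ (by simp)]
  simp [Fin.prod_univ_four, vec_apply]

/-- Lexicographic comparison of exponent vectors. -/
def LexLT (v d : Fin 4 → ℕ) : Prop := ∃ j, (∀ i < j, v i = d i) ∧ v j < d j

instance (v d : Fin 4 → ℕ) : Decidable (LexLT v d) := by
  unfold LexLT
  infer_instance

lemma LexLT.lt {v d : Fin 4 → ℕ} (h : LexLT v d) : vec v ≺[MonomialOrder.lex] vec d := by
  obtain ⟨j, h1, h2⟩ := h
  rw [MonomialOrder.lex_lt_iff, Finsupp.Lex.lt_iff]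
  exact ⟨j, h1, h2⟩

/-- A polynomial which is a nonzero multiple of the monomial `d` plus terms that are smaller in the
lexicographic order has degree `d`. -/
lemma degree_eq_of_terms {f : MvPolynomial (Fin 4) ℂ} (d : Fin 4 → ℕ) (c : ℂ)
    (l : List ((Fin 4 → ℕ) × ℂ)) (hc : c ≠ 0) (hl : ∀ p ∈ l, LexLT p.1 d)
    (hf : f = monomial (vec d) c + (l.map fun p => monomial (vec p.1) p.2).sum) :
    MonomialOrder.lex.degree f = vec d ∧ f ≠ 0 := by
  have hg : (l.map fun p => (monomial (vec p.1) p.2 : MvPolynomial (Fin 4) ℂ)).sum ∈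
      restrictSupport ℂ {t | t ≺[MonomialOrder.lex] vec d} := by
    refine list_sum_mem fun y hy => ?_
    obtain ⟨p, hp, rfl⟩ := List.mem_map.1 hy
    rw [mem_restrictSupport_iff]
    exact (Finset.coe_subset.2 support_monomial_subset).trans (by simpa using (hl p hp).lt)
  rw [mem_restrictSupport_iff] at hg
  set g := (l.map fun p => (monomial (vec p.1) p.2 : MvPolynomial (Fin 4) ℂ)).sum
  have hcoeff : coeff (vec d) f = c := by
    have h0 : coeff (vec d) g = 0 := by
      by_contra h
      exact lt_irrefl (MonomialOrder.lex.toSyn (vec d)) (hg (mem_support_iff.2 h))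
    rw [hf, coeff_add, h0, coeff_monomial, if_pos rfl, add_zero]
  have hne : f ≠ 0 := by
    rintro rfl
    exact hc (by simpa using hcoeff.symm)
  refine ⟨MonomialOrder.lex.toSyn.injective (le_antisymm ?_ ?_), hne⟩
  · rw [MonomialOrder.degree_le_iff]
    intro t ht
    rw [hf] at ht
    rcases Finset.mem_union.1 (support_add ht) with h | h
    · rw [Finset.mem_singleton.1 (support_monomial_subset h)]
    · exact (hg h).le
  · exact MonomialOrder.le_degree (mem_support_iff.2 (hcoeff ▸ hc))

/-- The substitution `x₁ = a²`, `x₂ = ac`, `x₃ = ab`, `x₄ = e - bc`, where `a, b, c, e` are the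
variables `X 0, X 1, X 2, X 3`. -/
def toABCE : MvPolynomial (Fin 4) ℂ →ₐ[ℂ] MvPolynomial (Fin 4) ℂ :=
  aeval ![X 0 ^ 2, X 0 * X 2, X 0 * X 1, X 3 - X 1 * X 2]

/-- The lexicographic leading exponent of `φ_ij` after the substitution `toABCE`. -/
def leadExp : Edge → Fin 4 → ℕ
  | e13 => ![4, 0, 0, 0] | e14 => ![4, 0, 0, 0] | e23 => ![4, 0, 0, 0] | e24 => ![4, 0, 0, 0]
  | e12 => ![3, 1, 0, 0] | e34 => ![3, 1, 0, 0] | e03 => ![3, 0, 1, 0] | e04 => ![3, 0, 1, 0]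
  | e02 => ![2, 1, 1, 0] | e01 => ![2, 0, 0, 1]

/-- The leading coefficient of `φ_ij` after the substitution `toABCE`. -/
def leadCoeff : Edge → ℂ
  | e01 => -2
  | e02 => 4 * Complex.I
  | e03 => 2 * Complex.I
  | e04 => -2
  | e12 => 2
  | e13 => -1
  | e14 => Complex.I
  | e23 => -Complex.I
  | e24 => 1
  | e34 => 2

/-- The terms of `φ_ij` other than the leading one after the substitution `toABCE`. -/
def lowerTerms : Edge → List ((Fin 4 → ℕ) × ℂ)
  | e01 => []
  | e02 => [(![2, 0, 0, 1], -2 * Complex.I)]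
  | e03 => [(![1, 1, 0, 1], 2 * Complex.I), (![1, 2, 1, 0], -2 * Complex.I)]
  | e04 => [(![1, 1, 0, 1], 2), (![1, 2, 1, 0], -2)]
  | e12 => [(![1, 0, 1, 1], -2), (![1, 1, 2, 0], 2)]
  | e13 => [(![2, 0, 2, 0], -1), (![2, 2, 0, 0], 1),
      (![0, 0, 0, 2], 1), (![0, 1, 1, 1], -2), (![0, 2, 2, 0], 1)]
  | e14 => [(![2, 0, 2, 0], Complex.I), (![2, 2, 0, 0], Complex.I),
      (![0, 0, 0, 2], Complex.I), (![0, 1, 1, 1], -2 * Complex.I), (![0, 2, 2, 0], Complex.I)]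
  | e23 => [(![2, 0, 2, 0], Complex.I), (![2, 2, 0, 0], -Complex.I),
      (![0, 0, 0, 2], Complex.I), (![0, 1, 1, 1], -2 * Complex.I), (![0, 2, 2, 0], Complex.I)]
  | e24 => [(![2, 0, 2, 0], -1), (![2, 2, 0, 0], -1),
      (![0, 0, 0, 2], 1), (![0, 1, 1, 1], -2), (![0, 2, 2, 0], 1)]
  | e34 => [(![1, 0, 1, 1], 2), (![1, 1, 2, 0], -2)]

lemma toABCE_phi (e : Edge) :
    toABCE (phi e) = monomial (vec (leadExp e)) (leadCoeff e) +
      ((lowerTerms e).map fun p => monomial (vec p.1) p.2).sum := by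
  have h2 : toABCE 2 = 2 := map_ofNat _ 2
  have hC (c : ℂ) : toABCE (C c) = C c := toABCE.commutes c
  have hx (i : Fin 4) : toABCE (X i) =
      (![X 0 ^ 2, X 0 * X 2, X 0 * X 1, X 3 - X 1 * X 2] : Fin 4 → MvPolynomial (Fin 4) ℂ) i :=
    aeval_X _ i
  have C2 : (C 2 : MvPolynomial (Fin 4) ℂ) = 2 := map_ofNat C 2
  have C4 : (C 4 : MvPolynomial (Fin 4) ℂ) = 4 := map_ofNat C 4
  cases e <;>
  · simp [monomial_vec, phi, leadExp, leadCoeff, lowerTerms, h2, hC, hx, C2, C4]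
    try ring

lemma lexLT_of_mem_lowerTerms (e : Edge) : ∀ p ∈ lowerTerms e, LexLT p.1 (leadExp e) := by
  cases e <;> simp [lowerTerms, leadExp] <;> decide

lemma degree_toABCE_phi (e : Edge) :
    MonomialOrder.lex.degree (toABCE (phi e)) = vec (leadExp e) ∧ toABCE (phi e) ≠ 0 :=
  degree_eq_of_terms _ _ _ (by cases e <;> simp [leadCoeff]) (lexLT_of_mem_lowerTerms e)
    (toABCE_phi e)

/-! ### The image of a monomial under `Φ` -/

/-- The factor from `ℂ[V]` of the image of a variable under `Φ`. -/
def phiVar : Var → MvPolynomial (Fin 4) ℂ := Sum.elim phi fun _ => 1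

/-- The image in `ℂ[V]` of a monomial in the `w_ij`, `u_k`, with `u_k ↦ 1`. -/
def phiMono (s : Var →₀ ℕ) : MvPolynomial (Fin 4) ℂ := s.prod fun i k => phiVar i ^ k

/-- The degree in `t₀, …, t₄` of the image of a variable under `Φ`. -/
def tdeg : Var → Fin 5 → ℤ :=
  Sum.elim (fun e => Pi.single e.fst 1 + Pi.single e.snd 1) fun k => Pi.single k (-2)

/-- `leadExp`, extended to the variables `u_k`. -/
def leadExpVar : Var → Fin 4 →₀ ℕ := Sum.elim (fun e => vec (leadExp e)) fun _ => 0

lemma coe_Phi_X (i : Var) : (Phi (X i)).1 = AddMonoidAlgebra.single (tdeg i) (phiVar i) := by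
  rcases i with e | k
  · rw [coe_Phi_X_inl]
    simp [phiBar', const, tpow, tdeg, phiVar, AddMonoidAlgebra.single_mul_single]
  · rw [coe_Phi_X_inr]
    simp [tpow, tdeg, phiVar]

lemma coe_Phi_monomial (s : Var →₀ ℕ) (c : ℂ) :
    (Phi (monomial s c)).1 =
      AddMonoidAlgebra.single (Finsupp.weight tdeg s) (C c * phiMono s) := by
  unfold phiMono
  induction s using Finsupp.induction_linear generalizing c with
  | zero =>
    rw [← C_apply, ← algebraMap_eq, AlgHom.commutes]
    simp
  | add s t hs ht =>
    rw [← mul_one c, ← monomial_mul, map_mul]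
    refine (congrArg₂ (· * ·) (hs c) (ht 1)).trans ?_
    simp only [AddMonoidAlgebra.single_mul_single]
    rw [map_add, Finsupp.prod_add_index' (by simp) (by simp [pow_add])]
    congr 1
    simp [mul_assoc]
  | single i n =>
    rw [← C_mul_X_pow_eq_monomial, map_mul, map_pow, ← algebraMap_eq, AlgHom.commutes]
    refine (congrArg (fun y => algebraMap ℂ (Laurent (Fin 5)) c * y ^ n) (coe_Phi_X i)).trans ?_
    rw [AddMonoidAlgebra.single_pow]
    simp [Finsupp.weight_single, AddMonoidAlgebra.single_mul_single, Finsupp.prod_single_index]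

/-- The pairs `(i, j)` form a finite type. -/
instance : Fintype Edge where
  elems := {e01, e02, e03, e04, e12, e13, e14, e23, e24, e34}
  complete e := by cases e <;> decide

lemma sum_edge {M : Type} [AddCommMonoid M] (f : Edge → M) :
    ∑ e, f e = f e01 + f e02 + f e03 + f e04 + f e12 + f e13 + f e14 + f e23 + f e24 + f e34 := by
  have : (Finset.univ : Finset Edge) = {e01, e02, e03, e04, e12, e13, e14, e23, e24, e34} := rfl
  rw [this]
  simp [add_assoc]

lemma weight_eq_sum {M : Type} [AddCommMonoid M] (f : Var → M) (s : Var →₀ ℕ) :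
    Finsupp.weight f s = ∑ e, s (w e) • f (w e) + ∑ k, s (u k) • f (u k) := by
  rw [Finsupp.weight_apply, Finsupp.sum_fintype _ _ (by simp), Fintype.sum_sum_type]

lemma sameDegree_of_weight_eq {s s' : Var →₀ ℕ}
    (ht : Finsupp.weight tdeg s = Finsupp.weight tdeg s')
    (hl : Finsupp.weight leadExpVar s = Finsupp.weight leadExpVar s') :
    SameDegree (fun e => s (w e)) (fun k => s (u k)) (fun e => s' (w e)) (fun k => s' (u k)) := by
  rw [weight_eq_sum, weight_eq_sum, sum_edge, sum_edge, Fin.sum_univ_five, Fin.sum_univ_five] at ht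
  rw [weight_eq_sum, weight_eq_sum, sum_edge, sum_edge] at hl
  constructor
  · have := DFunLike.congr_fun hl 0
    simp [leadExpVar, vec_apply, leadExp] at this
    omega
  · have := DFunLike.congr_fun hl 1
    simp [leadExpVar, vec_apply, leadExp] at this
    omega
  · have := DFunLike.congr_fun hl 2
    simp [leadExpVar, vec_apply, leadExp] at this
    omega
  · have := DFunLike.congr_fun hl 3
    simpa [leadExpVar, vec_apply, leadExp] using this
  · have := congrFun ht 0
    simp [tdeg, Edge.fst, Edge.snd] at this
    omega
  · have := congrFun ht 1
    simp [tdeg, Edge.fst, Edge.snd] at this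
    omega
  · have := congrFun ht 2
    simp [tdeg, Edge.fst, Edge.snd] at this
    omega
  · have := congrFun ht 3
    simp [tdeg, Edge.fst, Edge.snd] at this
    omega
  · have := congrFun ht 4
    simp [tdeg, Edge.fst, Edge.snd] at this
    omega

lemma IsStandard.eq_of_weight_eq {s s' : Var →₀ ℕ} (hs : IsStandard s) (hs' : IsStandard s')
    (ht : Finsupp.weight tdeg s = Finsupp.weight tdeg s')
    (hl : Finsupp.weight leadExpVar s = Finsupp.weight leadExpVar s') : s = s' := by
  obtain ⟨h1, h2⟩ := (sameDegree_of_weight_eq ht hl).eq hs.leadFree hs'.leadFree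
  ext (e | k)
  · exact congrFun h1 e
  · exact congrFun h2 k

/-! ### The kernel of `Φ` -/

/-- The image in `ℂ[a, b, c, e]` of a monomial in the `w_ij`, `u_k`, with `u_k ↦ 1`. -/
def monoImage (s : Var →₀ ℕ) : MvPolynomial (Fin 4) ℂ :=
  toABCE (phiMono s)

lemma monoImage_ne_zero_and_degree (s : Var →₀ ℕ) : monoImage s ≠ 0 ∧
    MonomialOrder.lex.degree (monoImage s) = Finsupp.weight leadExpVar s := by
  have h (i : Var) : toABCE (phiVar i) ≠ 0 ∧
      MonomialOrder.lex.degree (toABCE (phiVar i)) = leadExpVar i := by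
    rcases i with e | k
    · exact ⟨(degree_toABCE_phi e).2, (degree_toABCE_phi e).1⟩
    · simp [phiVar, leadExpVar]
  have he : monoImage s = ∏ i ∈ s.support, toABCE (phiVar i) ^ s i := by
    simp [monoImage, phiMono, Finsupp.prod, map_prod, map_pow]
  rw [he]
  refine ⟨Finset.prod_ne_zero_iff.2 fun i _ => pow_ne_zero _ (h i).1, ?_⟩
  rw [MonomialOrder.degree_prod fun i _ => pow_ne_zero _ (h i).1, Finsupp.weight_apply]
  exact Finset.sum_congr rfl fun i _ => by rw [MonomialOrder.degree_pow, (h i).2]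

lemma coe_Phi_apply (r : MvPolynomial Var ℂ) (d : Fin 5 → ℤ) :
    (Phi r).1.coeff d = ∑ s ∈ r.support with Finsupp.weight tdeg s = d,
      C (coeff s r) * phiMono s := by
  classical
  have h : (Phi r).1 = ∑ s ∈ r.support, AddMonoidAlgebra.single (Finsupp.weight tdeg s)
      (C (coeff s r) * phiMono s) := by
    conv_lhs => rw [r.as_sum, map_sum]
    rw [← Subalgebra.coe_val, map_sum]
    exact Finset.sum_congr rfl fun s _ => coe_Phi_monomial s _
  rw [h, Finset.sum_filter]
  rw [AddMonoidAlgebra.coeff_sum, Finsupp.finsetSum_apply]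
  exact Finset.sum_congr rfl fun s _ => by
    rw [AddMonoidAlgebra.coeff_single, Finsupp.single_apply]

/-- The standard monomials have linearly independent images: those of equal degree in
`t₀, …, t₄` have distinct leading exponents in `ℂ[a, b, c, e]`. -/
lemma eq_zero_of_Phi_eq_zero {r : MvPolynomial Var ℂ}
    (hr : r ∈ restrictSupport ℂ {s | IsStandard s}) (h : Phi r = 0) : r = 0 := by
  classical
  by_contra hne
  rw [mem_restrictSupport_iff] at hr
  obtain ⟨s₀, hs₀⟩ := Finset.nonempty_of_ne_empty (mt support_eq_empty.1 hne)
  set S := r.support.filter fun s => Finsupp.weight tdeg s = Finsupp.weight tdeg s₀ with hS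
  obtain ⟨s₁, hs₁, hmax⟩ := S.exists_max_image
    (fun s => MonomialOrder.lex.toSyn (Finsupp.weight leadExpVar s))
    ⟨s₀, Finset.mem_filter.2 ⟨hs₀, rfl⟩⟩
  have hsum : ∑ s ∈ S, C (coeff s r) * monoImage s = 0 := by
    have h0 := coe_Phi_apply r (Finsupp.weight tdeg s₀)
    rw [h] at h0
    have h1 := congrArg toABCE h0.symm
    rw [map_sum] at h1
    simp only [map_mul] at h1
    refine Eq.trans (Finset.sum_congr rfl fun s _ => ?_) (h1.trans (map_zero toABCE))
    rw [monoImage]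
    congr 1
    exact (toABCE.commutes _).symm
  have hcoeff := congrArg (coeff (Finsupp.weight leadExpVar s₁)) hsum
  rw [coeff_sum, coeff_zero, Finset.sum_eq_single_of_mem s₁ hs₁, coeff_C_mul, mul_eq_zero] at hcoeff
  · rcases hcoeff with h0 | h0
    · exact mem_support_iff.1 (Finset.mem_filter.1 hs₁).1 h0
    · rw [← (monoImage_ne_zero_and_degree s₁).2] at h0
      exact MonomialOrder.lex.coeff_degree_ne_zero_iff.2 (monoImage_ne_zero_and_degree s₁).1 h0
  · intro s hs hne'
    have hlt : MonomialOrder.lex.degree (monoImage s) ≺[MonomialOrder.lex]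
        Finsupp.weight leadExpVar s₁ := ?_
    · rw [coeff_C_mul, MonomialOrder.lex.coeff_eq_zero_of_lt hlt, mul_zero]
    rw [(monoImage_ne_zero_and_degree s).2]
    refine lt_of_le_of_ne (hmax s hs) fun heq => hne' ?_
    rw [hS, Finset.mem_filter] at hs hs₁
    exact (hr hs.1).eq_of_weight_eq (hr hs₁.1) (hs.2.trans hs₁.2.symm)
      (MonomialOrder.lex.toSyn.injective heq)

lemma ker_Phi : RingHom.ker Phi = Ideal.span (Set.range gen') := by
  have hle : Ideal.span (Set.range gen') ≤ RingHom.ker Phi := by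
    rw [Ideal.span_le]
    rintro _ ⟨n, rfl⟩
    exact Phi_gen' n
  refine le_antisymm (fun f hf => ?_) hle
  obtain ⟨r, hr, hfr⟩ := exists_standard_sub_mem f
  have h : Phi r = 0 := by
    have h1 : f - (f - r) ∈ RingHom.ker Phi := Ideal.sub_mem _ hf (hle hfr)
    rwa [sub_sub_cancel] at h1
  rwa [eq_zero_of_Phi_eq_zero hr h, sub_zero] at hfr

/-! ### The kernel of `Ψ`: parity and homogenization -/

/-- For `k = 1, 3, 4` a linear automorphism of `V` multiplies `φ_ij` by `-1` if `k ∈ {i, j}` and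
fixes it otherwise. -/
lemma exists_reflection (k : Fin 5) (hk : ¬(k = 0 ∨ k = 2)) :
    ∃ T : MvPolynomial (Fin 4) ℂ →ₐ[ℂ] MvPolynomial (Fin 4) ℂ,
      ∀ e, T (phi e) = if e.fst = k ∨ e.snd = k then -phi e else phi e := by
  have hI : (C Complex.I : MvPolynomial (Fin 4) ℂ) ^ 2 = -1 := by
    rw [← C_pow, Complex.I_sq, C_neg, C_1]
  have key (v : Fin 4 → MvPolynomial (Fin 4) ℂ) (e : Edge) : aeval v (phi e) = match e with
      | e13 => -v 0 ^ 2 - v 1 ^ 2 + v 2 ^ 2 + v 3 ^ 2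
      | e14 => C Complex.I * (v 0 ^ 2 + v 1 ^ 2 + v 2 ^ 2 + v 3 ^ 2)
      | e34 => 2 * (v 0 * v 2 + v 1 * v 3)
      | e01 => -2 * (v 0 * v 3 + v 1 * v 2)
      | e03 => 2 * C Complex.I * (v 0 * v 1 + v 2 * v 3)
      | e04 => 2 * (-(v 0 * v 1) + v 2 * v 3)
      | e12 => 2 * (v 0 * v 2 - v 1 * v 3)
      | e23 => C Complex.I * (-v 0 ^ 2 + v 1 ^ 2 - v 2 ^ 2 + v 3 ^ 2)
      | e24 => v 0 ^ 2 - v 1 ^ 2 - v 2 ^ 2 + v 3 ^ 2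
      | e02 => 2 * C Complex.I * (-(v 0 * v 3) + v 1 * v 2) := by
    have h2 : aeval v (2 : MvPolynomial (Fin 4) ℂ) = 2 := map_ofNat _ 2
    have hC : aeval v (C Complex.I : MvPolynomial (Fin 4) ℂ) = C Complex.I :=
      (aeval v).commutes _
    have hx (i : Fin 4) : aeval v (X i : MvPolynomial (Fin 4) ℂ) = v i := aeval_X v i
    cases e <;> simp only [phi, map_add, map_sub, map_neg, map_mul, map_pow, h2, hC, hx]
  have h : k = 1 ∨ k = 3 ∨ k = 4 := by
    revert k
    decide
  rcases h with rfl | rfl | rfl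
  · refine ⟨aeval ![C Complex.I * X 1, -C Complex.I * X 0, -C Complex.I * X 3, C Complex.I * X 2],
      fun e => ?_⟩
    rw [key]
    cases e <;>
      simp only [Edge.fst, Edge.snd, phi, x, Matrix.cons_val, Fin.isValue, Fin.reduceEq, or_false,
        or_true, or_self, if_true, if_false] <;> grind
  · refine ⟨aeval ![X 3, -X 2, -X 1, X 0], fun e => ?_⟩
    rw [key]
    cases e <;>
      simp only [Edge.fst, Edge.snd, phi, x, Matrix.cons_val, Fin.isValue, Fin.reduceEq, or_false,
        or_true, or_self, if_true, if_false] <;> ring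
  · refine ⟨aeval ![C Complex.I * X 3, -C Complex.I * X 2, C Complex.I * X 1, -C Complex.I * X 0],
      fun e => ?_⟩
    rw [key]
    cases e <;>
      simp only [Edge.fst, Edge.snd, phi, x, Matrix.cons_val, Fin.isValue, Fin.reduceEq, or_true,
        or_self, if_true, if_false] <;> grind

lemma exists_phiMono_eq_neg_one_zpow (k : Fin 5) (hk : ¬(k = 0 ∨ k = 2)) :
    ∃ T : MvPolynomial (Fin 4) ℂ →ₐ[ℂ] MvPolynomial (Fin 4) ℂ,
      ∀ s, T (phiMono s) = (-1 : ℂ) ^ (Finsupp.weight tdeg s k) • phiMono s := by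
  obtain ⟨T, hT⟩ := exists_reflection k hk
  have hvar (i : Var) : T (phiVar i) = (-1 : ℂ) ^ (tdeg i k) • phiVar i := by
    rcases i with e | j
    · refine (hT e).trans ?_
      have hne : e.fst ≠ e.snd := by cases e <;> decide
      simp only [phiVar, tdeg, Sum.elim_inl, Pi.add_apply, Pi.single_apply]
      by_cases h1 : k = e.fst
      · subst h1
        simp [hne]
      · by_cases h2 : k = e.snd
        · subst h2
          simp [Ne.symm hne]
        · simp [h1, h2, Ne.symm h1, Ne.symm h2]
    · simp only [phiVar, tdeg, Sum.elim_inr, Pi.single_apply, map_one]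
      split_ifs <;> simp
  refine ⟨T, fun s => ?_⟩
  induction s using Finsupp.induction_linear with
  | zero => simp [phiMono]
  | add s t hs ht =>
    have hadd : phiMono (s + t) = phiMono s * phiMono t :=
      Finsupp.prod_add_index' (by simp) (by simp [pow_add])
    rw [hadd, map_mul, hs, ht, map_add, Pi.add_apply, zpow_add₀ (by norm_num), smul_mul_smul_comm]
  | single i n =>
    have hs : phiMono (Finsupp.single i n) = phiVar i ^ n := by simp [phiMono]
    rw [hs, map_pow, hvar, Finsupp.weight_single, smul_pow]
    simp only [Pi.smul_apply, nsmul_eq_mul]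
    rw [mul_comm, zpow_mul, zpow_natCast]

/-- A linear relation between the `phiMono s` splits according to the parity of the degree of the
monomials in `t_k`. -/
lemma sum_filter_even_eq_zero (k : Fin 5) (hk : ¬(k = 0 ∨ k = 2)) (A : Finset (Var →₀ ℕ))
    (c : (Var →₀ ℕ) → ℂ) (h : ∑ s ∈ A, C (c s) * phiMono s = 0) (j : ℤ) :
    ∑ s ∈ A with Even (Finsupp.weight tdeg s k + j), C (c s) * phiMono s = 0 := by
  obtain ⟨T, hT⟩ := exists_phiMono_eq_neg_one_zpow k hk
  have h1 := congrArg T h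
  rw [map_zero, map_sum] at h1
  have h2 : (2 : MvPolynomial (Fin 4) ℂ) *
      ∑ s ∈ A with Even (Finsupp.weight tdeg s k + j), C (c s) * phiMono s =
      ∑ s ∈ A, C (c s) * phiMono s +
        C ((-1) ^ j) * ∑ s ∈ A, T (C (c s) * phiMono s) := by
    rw [Finset.sum_filter, Finset.mul_sum, Finset.mul_sum, ← Finset.sum_add_distrib]
    refine Finset.sum_congr rfl fun s _ => ?_
    have hC : T (C (c s)) = C (c s) := T.commutes _
    rw [map_mul, hC, hT, smul_eq_C_mul]
    have h3 : (C ((-1) ^ j) : MvPolynomial (Fin 4) ℂ) *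
        (C (c s) * (C ((-1) ^ (Finsupp.weight tdeg s k)) * phiMono s)) =
        C ((-1) ^ (Finsupp.weight tdeg s k + j)) * (C (c s) * phiMono s) := by
      rw [zpow_add₀ (by norm_num), C_mul]
      ring
    rw [h3]
    split_ifs with he
    · rw [he.neg_one_zpow, C_1]
      ring
    · rw [(Int.not_even_iff_odd.1 he).neg_one_zpow, C_neg, C_1]
      ring
  rw [h, h1, mul_zero, add_zero] at h2
  exact (mul_eq_zero.1 h2).resolve_left two_ne_zero

/-- The exponents of monomials whose image under `Φ` has degree `0` or `1` in each of
`t₁, t₃, t₄`. -/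
def lowDegree : Set (Var →₀ ℕ) :=
  {s | ∀ k, ¬(k = 0 ∨ k = 2) → Finsupp.weight tdeg s k = 0 ∨ Finsupp.weight tdeg s k = 1}

/-- The coefficients of the image in `R`, where only the degrees in `t₀` and `t₂` remain. -/
lemma coe_resR_Phi_apply (F : MvPolynomial Var ℂ) (d : K → ℤ) :
    (resR (Phi F)).1.coeff d =
      ∑ s ∈ F.support with (fun k : K => Finsupp.weight tdeg s k) = d,
        C (coeff s F) * phiMono s := by
  classical
  have h : (resR (Phi F)).1 = ∑ s ∈ F.support,
      AddMonoidAlgebra.single (fun k : K => Finsupp.weight tdeg s k)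
        (C (coeff s F) * phiMono s) := by
    change specT (Phi F).1 = _
    conv_lhs => rw [F.as_sum, map_sum]
    rw [← Subalgebra.coe_val, map_sum, map_sum]
    refine Finset.sum_congr rfl fun s _ => ?_
    rw [Subalgebra.coe_val, coe_Phi_monomial]
    simp only [specT, AddMonoidAlgebra.mapDomainAlgHom_apply, AddMonoidAlgebra.mapDomain_single]
    rfl
  rw [h, Finset.sum_filter, AddMonoidAlgebra.coeff_sum, Finsupp.finsetSum_apply]
  exact Finset.sum_congr rfl fun s _ => by
    rw [AddMonoidAlgebra.coeff_single, Finsupp.single_apply]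

/-- For exponents in `lowDegree` the degrees in `t₁, t₃, t₄` are determined by their parities, so
nothing is lost by setting `t₁, t₃, t₄` to `1`. -/
lemma Phi_eq_zero_of_Psi_subst_eq_zero {F : MvPolynomial Var ℂ}
    (hF : F ∈ restrictSupport ℂ lowDegree) (h : Psi (subst F) = 0) : Phi F = 0 := by
  classical
  rw [mem_restrictSupport_iff] at hF
  rw [Psi_subst] at h
  refine Subtype.ext (AddMonoidAlgebra.ext (Finsupp.ext fun d => ?_))
  change (Phi F).1.coeff d = 0
  rw [coe_Phi_apply]
  have h0 := coe_resR_Phi_apply F fun k => d k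
  rw [h] at h0
  have h4 := sum_filter_even_eq_zero 4 (by decide) _ _
    (sum_filter_even_eq_zero 3 (by decide) _ _
      (sum_filter_even_eq_zero 1 (by decide) _ _ h0.symm (d 1)) (d 3)) (d 4)
  rw [Finset.filter_filter, Finset.filter_filter, Finset.filter_filter] at h4
  -- If `d` is not `0` or `1` at `t₁, t₃, t₄`, no monomial of `F` has degree `d`.
  by_cases hd : ∀ k, ¬(k = 0 ∨ k = 2) → d k = 0 ∨ d k = 1
  · refine Eq.trans (Finset.sum_congr (Finset.filter_congr fun s hs => ?_) fun _ _ => rfl) h4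
    constructor
    · rintro rfl
      exact ⟨rfl, Even.add_self _, Even.add_self _, Even.add_self _⟩
    · rintro ⟨hK, h1, h3, h4⟩
      have hl := hF hs
      have aux (k : Fin 5) (hk : ¬(k = 0 ∨ k = 2)) (he : Even (Finsupp.weight tdeg s k + d k)) :
          Finsupp.weight tdeg s k = d k := by
        have := hl k hk
        have := hd k hk
        obtain ⟨r, hr⟩ := he
        omega
      funext k
      by_cases hk : k = 0 ∨ k = 2
      · exact congrFun hK ⟨k, hk⟩
      · refine aux k hk ?_
        fin_cases k
        · exact absurd (Or.inl rfl) hk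
        · exact h1
        · exact absurd (Or.inr rfl) hk
        · exact h3
        · exact h4
  · refine Finset.sum_eq_zero fun s hs => absurd (fun k hk => ?_) hd
    rw [Finset.mem_filter] at hs
    exact hs.2 ▸ hF hs.1 k hk

/-- Insert the powers of `u₁, u₃, u₄` that bring the degrees in `t₁, t₃, t₄` down to `0` or `1`. -/
def homogenize (s : Edge ⊕ K →₀ ℕ) : Var →₀ ℕ :=
  Finsupp.equivFunOnFinite.symm (Sum.elim (fun e => s (Sum.inl e)) fun k =>
    if h : k = 0 ∨ k = 2 then s (Sum.inr ⟨k, h⟩)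
    else (∑ e, if e.fst = k ∨ e.snd = k then s (Sum.inl e) else 0) / 2)

lemma homogenize_mem_lowDegree (s : Edge ⊕ K →₀ ℕ) : homogenize s ∈ lowDegree := by
  intro k hk
  rw [weight_eq_sum, Pi.add_apply, Finset.sum_apply, Finset.sum_apply]
  have h1 : ∑ j, (homogenize s (u j) • tdeg (u j)) k = -2 * homogenize s (u k) := by
    rw [Finset.sum_eq_single k]
    · simp [tdeg, mul_comm]
    · intro j _ hj
      simp [tdeg, hj.symm]
    · simp
  have h2 : ∑ e, (homogenize s (w e) • tdeg (w e)) k =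
      ((∑ e, if e.fst = k ∨ e.snd = k then s (Sum.inl e) else 0 : ℕ) : ℤ) := by
    rw [Nat.cast_sum]
    refine Finset.sum_congr rfl fun e _ => ?_
    have hne : e.fst ≠ e.snd := by cases e <;> decide
    have h3 : homogenize s (w e) = s (Sum.inl e) := rfl
    simp only [h3, tdeg, Sum.elim_inl, Pi.smul_apply, Pi.add_apply, Pi.single_apply]
    by_cases h1 : k = e.fst
    · subst h1
      simp [hne]
    · by_cases h2 : k = e.snd
      · subst h2
        simp [Ne.symm hne]
      · simp [h1, h2, Ne.symm h1, Ne.symm h2]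
  have h3 : homogenize s (u k) =
      (∑ e, if e.fst = k ∨ e.snd = k then s (Sum.inl e) else 0) / 2 := dif_neg hk
  rw [h1, h2, h3]
  omega

lemma subst_monomial_homogenize (s : Edge ⊕ K →₀ ℕ) (c : ℂ) :
    subst (monomial (homogenize s) c) = monomial s c := by
  rw [subst, aeval_monomial, Finsupp.prod_fintype _ _ (by simp), Fintype.prod_sum_type,
    monomial_eq, Finsupp.prod_fintype _ _ (by simp), Fintype.prod_sum_type, algebraMap_eq]
  congr 2
  have hK : (Finset.univ : Finset K) = {k0, k2} := by decide
  rw [hK, Finset.prod_pair (by decide), Fin.prod_univ_five]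
  simp [homogenize]

lemma ker_Psi : RingHom.ker Psi = Ideal.span (Set.range gen) := by
  refine le_antisymm (fun f hf => ?_) (Ideal.span_le.2 ?_)
  · set F : MvPolynomial Var ℂ := ∑ s ∈ f.support, monomial (homogenize s) (coeff s f) with hF
    have hsub : subst F = f := by
      conv_rhs => rw [f.as_sum]
      rw [hF, map_sum]
      exact Finset.sum_congr rfl fun s _ => subst_monomial_homogenize s _
    have hmem : F ∈ restrictSupport ℂ lowDegree := by
      refine Submodule.sum_mem _ fun s _ => ?_
      rw [mem_restrictSupport_iff]
      exact (Finset.coe_subset.2 support_monomial_subset).trans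
        (by simpa using homogenize_mem_lowDegree s)
    have hker : F ∈ RingHom.ker Phi :=
      Phi_eq_zero_of_Psi_subst_eq_zero hmem (by rw [hsub]; exact hf)
    rw [ker_Phi] at hker
    have h := Ideal.mem_map_of_mem subst hker
    rw [Ideal.map_span, hsub, ← Set.range_comp] at h
    convert h using 3
    exact funext fun n => (subst_gen' n).symm
  · rintro _ ⟨n, rfl⟩
    exact Psi_gen n

/-! ### The cartesian square -/

/-- A commutative square of surjections of rings with `p ∘ f = q ∘ g` is a pushout square as soon
as the kernel of `p` is the image under `f` of the kernel of `g`. -/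
lemma isPushout_of_ker_le {A B C D : Type} [CommRing A] [CommRing B] [CommRing C] [CommRing D]
    (f : A →+* B) (g : A →+* C) (p : B →+* D) (q : C →+* D) (hcomm : p.comp f = q.comp g)
    (hg : Function.Surjective g) (hp : Function.Surjective p)
    (hker : RingHom.ker p ≤ (RingHom.ker g).map f) :
    IsPushout (CommRingCat.ofHom f) (CommRingCat.ofHom g) (CommRingCat.ofHom p)
      (CommRingCat.ofHom q) := by
  have comm : CommRingCat.ofHom f ≫ CommRingCat.ofHom p =
      CommRingCat.ofHom g ≫ CommRingCat.ofHom q := by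
    rw [← CommRingCat.ofHom_comp, ← CommRingCat.ofHom_comp, hcomm]
  refine ⟨⟨comm⟩, ⟨Limits.PushoutCocone.IsColimit.mk comm
    (fun s => CommRingCat.ofHom (RingHom.liftOfSurjective p hp ⟨s.inl.hom, ?_⟩)) ?_ ?_ ?_⟩⟩
  · refine hker.trans (Ideal.map_le_iff_le_comap.2 fun a ha => ?_)
    have h := congrArg (fun φ => φ.hom a) s.condition
    have h' : s.inl.hom (f a) = s.inr.hom (g a) := h
    rw [Ideal.mem_comap, RingHom.mem_ker, h', (RingHom.mem_ker).1 ha, map_zero]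
  · intro s
    ext b
    simp [RingHom.liftOfRightInverse_comp_apply]
  · intro s
    ext c
    obtain ⟨a, rfl⟩ := hg c
    have h : q (g a) = p (f a) := (DFunLike.congr_fun hcomm a).symm
    have h' : s.inl.hom (f a) = s.inr.hom (g a) := congrArg (fun φ => φ.hom a) s.condition
    simp [h, h', RingHom.liftOfRightInverse_comp_apply]
  · intro s m h1 _
    ext d
    obtain ⟨b, rfl⟩ := hp d
    have h : m.hom (p b) = s.inl.hom b := congrArg (fun φ => φ.hom b) h1
    simp [h, RingHom.liftOfRightInverse_comp_apply]

lemma isPushout_subst_Phi :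
    IsPushout (CommRingCat.ofHom subst.toRingHom) (CommRingCat.ofHom (S := R') Phi.toRingHom)
      (CommRingCat.ofHom (S := R) Psi.toRingHom)
      (CommRingCat.ofHom (R := R') (S := R) resR.toRingHom) := by
  refine isPushout_of_ker_le (C := R') (D := R) _ _ _ _ (RingHom.ext Psi_subst)
    Phi_surjective Psi_surjective ?_
  refine (le_of_eq ker_Psi).trans (Ideal.span_le.2 ?_)
  rintro _ ⟨n, rfl⟩
  rw [← subst_gen']
  exact Ideal.mem_map_of_mem subst.toRingHom (Phi_gen' n)

end CoxD8

end

theorem proposition5p6 :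
    -- the kernels of the two presentations are generated by the explicit polynomials
    Function.Surjective CoxD8.Psi ∧
    RingHom.ker CoxD8.Psi = Ideal.span (Set.range CoxD8.gen) ∧
    Function.Surjective CoxD8.Phi ∧
    RingHom.ker CoxD8.Phi = Ideal.span (Set.range CoxD8.gen') ∧
    (∀ n : Fin 20, CoxD8.subst (CoxD8.gen' n) = CoxD8.gen n) ∧
    -- the map of affine spaces is the closed embedding of the locus `u₁ = u₃ = u₄ = 1`
    Function.Surjective CoxD8.subst ∧
    RingHom.ker CoxD8.subst = Ideal.span
      {X (Sum.inr 1) - 1, X (Sum.inr 3) - 1, X (Sum.inr 4) - 1} ∧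
    -- `Spec R` is the scheme-theoretic intersection of `ℂ¹²` and `Spec R'` in `ℂ¹⁵`
    IsPullback CoxD8.embR CoxD8.embRR' CoxD8.embA CoxD8.embR' :=
  ⟨CoxD8.Psi_surjective, CoxD8.ker_Psi, CoxD8.Phi_surjective, CoxD8.ker_Phi, CoxD8.subst_gen',
    CoxD8.subst_surjective, CoxD8.ker_subst,
    isPullback_SpecMap_of_isPushout _ _ _ _ CoxD8.isPushout_subst_Phi⟩
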